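/- Let $H^1(\mathbb{R}^3)$ be the Sobolev space of real-valued $u\in L^2(\mathbb{R}^3)$ with weak gradient $\nabla u\in L^2(\mathbb{R}^3)$, and let $H^1_r(\mathbb{R}^3)$ be its subspace of radial functions. Let $p\in(2,3)$ and, for $\lambda\in\mathbb{R}$ and $u\in H^1(\mathbb{R}^3)$, put $$I_\lambda(u)=\frac12\int_{\mathbb{R}^3}\left(|\nabla u|^2+u^2\right)dx+\frac{\lambda}{4}\int_{\mathbb{R}^3}\int_{\mathbb{R}^3}\frac{u^2(x)\,u^2(y)}{|x-y|}\,dx\,dy-\frac1p\int_{\mathbb{R}^3}|u|^p\,dx .$$ All these integrals are finite for every $u\in H^1(\mathbb{R}^3)$, so that $I_\lambda:H^1(\mathbb{R}^3)\to\mathbb{R}$ is well defined. There exists $\lambda_0>0$ (depending on $p$) such that $$\inf_{u\in H^1(\mathbb{R}^3)}I_\lambda(u)=0\ \text{ for every }\lambda\ge\lambda_0,\qquad \inf_{u\in H^1(\mathbb{R}^3)}I_\lambda(u)=-\infty\ \text{ for every }\lambda<\lambda_0 .$$ In contrast, for every $\lambda>0$ the restriction of $I_\lambda$ to $H^1_r(\mathbb{R}^3)$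 is bounded below. -/

import Mathlib

open MeasureTheory
open scoped ContDiff

noncomputable section

namespace SchrodingerPoissonSlater

/-- Three-dimensional Euclidean space. -/
abbrev R3 : Type := EuclideanSpace ℝ (Fin 3)

/-- `G` is a square integrable weak gradient of `u`: integration by parts holds against every
smooth compactly supported test function. -/
structure HasL2WeakGradient (u : R3 → ℝ) (G : R3 → R3) : Prop where
  memLp : MemLp G 2 volume
  integral_eq : ∀ φ : R3 → ℝ, ContDiff ℝ ∞ φ → HasCompactSupport φ → ∀ i : Fin 3,
    (∫ x, u x * fderiv ℝ φ x (EuclideanSpace.single i 1)) = - (∫ x, G x i * φ x)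

/-- The Sobolev space `H¹(ℝ³)` of real functions (as a set of representatives). -/
def H1 : Set (R3 → ℝ) :=
  {u | MemLp u 2 volume ∧ ∃ G : R3 → R3, HasL2WeakGradient u G}

/-- The subspace of radial functions in `H¹(ℝ³)`. -/
def H1rad : Set (R3 → ℝ) :=
  {u | u ∈ H1 ∧ ∃ f : ℝ → ℝ, ∀ᵐ x ∂(volume : Measure R3), u x = f ‖x‖}

open Classical in
/-- The weak gradient of `u` (only meaningful on `H1`, where it is unique up to null sets by
`HasL2WeakGradient.ae_eq`). -/
def weakGradient (u : R3 → ℝ) : R3 → R3 :=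
  if h : ∃ G : R3 → R3, HasL2WeakGradient u G then h.choose else 0

theorem hasL2WeakGradient_weakGradient {u : R3 → ℝ} (hu : u ∈ H1) :
    HasL2WeakGradient u (weakGradient u) := by
  unfold weakGradient
  rw [dif_pos hu.2]
  exact hu.2.choose_spec

theorem HasL2WeakGradient.ae_eq {u : R3 → ℝ} {G G' : R3 → R3}
    (h : HasL2WeakGradient u G) (h' : HasL2WeakGradient u G') : G =ᵐ[volume] G' := by
  have loc : ∀ {G : R3 → R3}, MemLp G 2 volume → ∀ i : Fin 3,
      LocallyIntegrable (fun x => G x i) volume := fun hG i =>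
    ((EuclideanSpace.proj (𝕜 := ℝ) i).comp_memLp' hG).locallyIntegrable (by norm_num)
  have key : ∀ i : Fin 3, ∀ᵐ x ∂(volume : Measure R3), G x i - G' x i = 0 := by
    intro i
    refine ae_eq_zero_of_integral_contDiff_smul_eq_zero
      ((loc h.memLp i).sub (loc h'.memLp i)) ?_
    intro φ hφ hc
    have i1 : Integrable (fun x => φ x * G x i) :=
      (loc h.memLp i).integrable_smul_left_of_hasCompactSupport hφ.continuous hc
    have i2 : Integrable (fun x => φ x * G' x i) :=
      (loc h'.memLp i).integrable_smul_left_of_hasCompactSupport hφ.continuous hc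
    have e := (h.integral_eq φ hφ hc i).symm.trans (h'.integral_eq φ hφ hc i)
    simp only [smul_eq_mul, mul_sub]
    rw [integral_sub i1 i2]
    simp only [mul_comm (φ _)]
    linarith
  filter_upwards [ae_all_iff.2 key] with x hx
  ext i
  linarith [hx i]

/-- The Coulomb integrand `u(x)² u(y)² / |x - y|`. -/
def coulombIntegrand (u : R3 → ℝ) (x y : R3) : ℝ :=
  u x ^ 2 * u y ^ 2 / ‖x - y‖

/-- The energy functional `I_λ`, with parameters `p` and `lam = λ`. -/
def energy (p lam : ℝ) (u : R3 → ℝ) : ℝ :=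
  (1 / 2) * (∫ x, (‖weakGradient u x‖ ^ 2 + u x ^ 2))
    + (lam / 4) * (∫ x, ∫ y, coulombIntegrand u x y)
    - (1 / p) * (∫ x, |u x| ^ p)

end SchrodingerPoissonSlater

end

/-!
Let `D(u)` be the Coulomb energy of the charge density `u²`. Since `|x|⁻²` convolved with itself is
at most a multiple of `|x|⁻¹`, bounding `|u|` by the Riesz potential of `|∇u|` and applying
Cauchy–Schwarz gives `(∫ |u|³)² ≤ (4 / π) (∫ |∇u|²) D(u)`. As `|u|^p ≤ u² + |u|³`, the energy is
nonnegative once `λ ≥ 2 / π`. Two distant translates of a test function have nearly twice its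
energy, so the infimum over test functions is either `0` or `-∞`; because the energy is monotone and
continuous in `λ`, the parameters with infimum `0` form a closed half-line, which does not contain
`0`.

For radial `u`, Strauss' pointwise bound confines `{|u| ≥ α}` to a ball of radius proportional to
`‖u‖_{H¹} / α`. The square of the mass on a ball is at most its diameter times `D(u)`, so on that
ball, too, the positive terms of the energy dominate `∫ |u|^p` up to a constant.
-/

noncomputable section

namespace SchrodingerPoissonSlater

open Set Filter Topology
open scoped ENNReal NNReal Convolution

theorem le_add_of_sq_le_four_mul {x a b : ℝ} (ha : 0 ≤ a) (hb : 0 ≤ b) (h : x ^ 2 ≤ 4 * (a * b)) :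
    x ≤ a + b := by
  nlinarith [sq_nonneg (a - b)]

section Lebesgue

variable {α E : Type*} [MeasurableSpace α] {μ : Measure α} [NormedAddCommGroup E]

theorem sq_lintegral_mul_le {f g : α → ℝ≥0∞} (hf : AEMeasurable f μ) (hg : AEMeasurable g μ) :
    (∫⁻ x, f x * g x ∂μ) ^ 2 ≤ (∫⁻ x, f x ^ 2 ∂μ) * ∫⁻ x, g x ^ 2 ∂μ := by
  calc (∫⁻ x, f x * g x ∂μ) ^ 2
      ≤ ((∫⁻ x, f x ^ 2 ∂μ) ^ (1 / 2 : ℝ) * (∫⁻ x, g x ^ 2 ∂μ) ^ (1 / 2 : ℝ)) ^ 2 := by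
        gcongr
        simpa using ENNReal.lintegral_mul_le_Lp_mul_Lq μ Real.HolderConjugate.two_two hf hg
    _ = (∫⁻ x, f x ^ 2 ∂μ) * ∫⁻ x, g x ^ 2 ∂μ := by
        rw [mul_pow, ← ENNReal.rpow_mul_natCast, ← ENNReal.rpow_mul_natCast]
        norm_num

theorem sq_lintegral_mul_le_lintegral_mul_sq {w f : α → ℝ≥0∞} (hw : AEMeasurable w μ)
    (hf : AEMeasurable f μ) :
    (∫⁻ x, w x * f x ∂μ) ^ 2 ≤ (∫⁻ x, w x ∂μ) * ∫⁻ x, w x * f x ^ 2 ∂μ := by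
  have sq_sqrt (x : α) : (w x ^ (1 / 2 : ℝ)) ^ 2 = w x := by
    rw [← ENNReal.rpow_mul_natCast]; norm_num
  have key := sq_lintegral_mul_le (hw.pow_const (1 / 2 : ℝ)) ((hw.pow_const (1 / 2 : ℝ)).mul hf)
  simpa only [Pi.mul_apply, mul_pow, ← mul_assoc, ← sq, sq_sqrt] using key

theorem rpow_le_rpow_add_rpow (x : ℝ≥0∞) {a q b : ℝ} (haq : a ≤ q) (hqb : q ≤ b) :
    x ^ q ≤ x ^ a + x ^ b := by
  rcases le_total x 1 with hx | hx
  · exact (ENNReal.rpow_le_rpow_of_exponent_ge hx haq).trans le_self_add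
  · exact (ENNReal.rpow_le_rpow_of_exponent_le hx hqb).trans le_add_self

theorem eLpNorm_rpow_le_add {a q b : ℝ≥0} (ha : a ≠ 0) (haq : a ≤ q) (hqb : q ≤ b) {f : α → E}
    (hf : AEStronglyMeasurable f μ) :
    eLpNorm f q μ ^ (q : ℝ) ≤ eLpNorm f a μ ^ (a : ℝ) + eLpNorm f b μ ^ (b : ℝ) := by
  have hq : q ≠ 0 := ((pos_iff_ne_zero.2 ha).trans_le haq).ne'
  have hb : b ≠ 0 := ((pos_iff_ne_zero.2 hq).trans_le hqb).ne'
  rw [eLpNorm_nnreal_pow_eq_lintegral ha, eLpNorm_nnreal_pow_eq_lintegral hq,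
    eLpNorm_nnreal_pow_eq_lintegral hb, ← lintegral_add_left' (hf.enorm.pow_const _)]
  exact lintegral_mono fun x => rpow_le_rpow_add_rpow _ haq hqb

theorem lintegral_enorm_pow_eq {n : ℕ} (hn : n ≠ 0) (f : α → E) :
    ∫⁻ x, ‖f x‖ₑ ^ n ∂μ = eLpNorm f n μ ^ n := by
  simpa using (eLpNorm_nnreal_pow_eq_lintegral (f := f) (μ := μ) (Nat.cast_ne_zero.2 hn)).symm

theorem memLp_of_memLp_of_memLp {a q b : ℝ≥0} (ha : a ≠ 0) (haq : a ≤ q) (hqb : q ≤ b) {f : α → E}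
    (hfa : MemLp f a μ) (hfb : MemLp f b μ) : MemLp f q μ := by
  have hq : (0 : ℝ) < q := (pos_iff_ne_zero.2 ha).trans_le haq
  refine ⟨hfa.1, (ENNReal.rpow_lt_top_iff_of_pos hq).1 ?_⟩
  refine (eLpNorm_rpow_le_add ha haq hqb hfa.1).trans_lt (ENNReal.add_lt_top.2 ⟨?_, ?_⟩)
  · exact ENNReal.rpow_lt_top_of_nonneg a.2 hfa.eLpNorm_ne_top
  · exact ENNReal.rpow_lt_top_of_nonneg b.2 hfb.eLpNorm_ne_top

theorem tendsto_eLpNorm_of_tendsto_of_tendsto {ι : Type*} {l : Filter ι} {a q b : ℝ≥0} (ha : a ≠ 0)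
    (haq : a ≤ q) (hqb : q ≤ b) {f : ι → α → E} (hf : ∀ i, AEStronglyMeasurable (f i) μ)
    (hfa : Tendsto (fun i => eLpNorm (f i) a μ) l (𝓝 0))
    (hfb : Tendsto (fun i => eLpNorm (f i) b μ) l (𝓝 0)) :
    Tendsto (fun i => eLpNorm (f i) q μ) l (𝓝 0) := by
  have hq : (0 : ℝ) < q := (pos_iff_ne_zero.2 ha).trans_le haq
  have ha' : (0 : ℝ) < a := NNReal.coe_pos.2 (pos_iff_ne_zero.2 ha)
  have hb' : (0 : ℝ) < b := hq.trans_le hqb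
  have hsum : Tendsto (fun i => eLpNorm (f i) a μ ^ (a : ℝ) + eLpNorm (f i) b μ ^ (b : ℝ)) l
      (𝓝 0) := by
    simpa [ENNReal.zero_rpow_of_pos, ha', hb'] using
      (hfa.ennrpow_const (a : ℝ)).add (hfb.ennrpow_const (b : ℝ))
  have hpow := tendsto_of_tendsto_of_tendsto_of_le_of_le tendsto_const_nhds hsum
    (fun _ => zero_le) fun i => eLpNorm_rpow_le_add ha haq hqb (hf i)
  simpa [← ENNReal.rpow_mul, hq.ne', ENNReal.zero_rpow_of_pos, hq] using
    hpow.ennrpow_const (q : ℝ)⁻¹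

theorem integrable_norm_rpow {q : ℝ≥0} (hq : q ≠ 0) {f : α → E} (hf : MemLp f q μ) :
    Integrable (fun x => ‖f x‖ ^ (q : ℝ)) μ := by
  simpa using hf.integrable_norm_rpow (by simpa) (by simp)

theorem tendsto_eLpNorm_of_tendsto_sub {ι : Type*} {l : Filter ι} {q : ℝ≥0∞} (hq : 1 ≤ q)
    {f : ι → α → E} {g : α → E} (hf : ∀ i, MemLp (f i) q μ) (hg : MemLp g q μ)
    (h : Tendsto (fun i => eLpNorm (f i - g) q μ) l (𝓝 0)) :
    Tendsto (fun i => eLpNorm (f i) q μ) l (𝓝 (eLpNorm g q μ)) := by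
  have : Fact (1 ≤ q) := ⟨hq⟩
  simpa only [Lp.enorm_toLp] using ((Lp.tendsto_Lp_iff_tendsto_eLpNorm'' f hf g hg).2 h).enorm

theorem integral_norm_rpow_eq {q : ℝ≥0} (hq : q ≠ 0) {f : α → E} (hf : AEStronglyMeasurable f μ) :
    ∫ x, ‖f x‖ ^ (q : ℝ) ∂μ = (eLpNorm f q μ ^ (q : ℝ)).toReal := by
  rw [eLpNorm_nnreal_pow_eq_lintegral hq, integral_eq_lintegral_of_nonneg_ae
    (ae_of_all _ fun x => by positivity) (hf.norm.aemeasurable.pow_const _).aestronglyMeasurable]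
  simp only [← ofReal_norm, ENNReal.ofReal_rpow_of_nonneg (norm_nonneg _) q.coe_nonneg]

theorem tendsto_integral_norm_rpow {ι : Type*} {l : Filter ι} {q : ℝ≥0} (hq : 1 ≤ q)
    {f : ι → α → E} {g : α → E} (hf : ∀ i, MemLp (f i) q μ) (hg : MemLp g q μ)
    (h : Tendsto (fun i => eLpNorm (f i - g) q μ) l (𝓝 0)) :
    Tendsto (fun i => ∫ x, ‖f i x‖ ^ (q : ℝ) ∂μ) l (𝓝 (∫ x, ‖g x‖ ^ (q : ℝ) ∂μ)) := by
  have hq0 : q ≠ 0 := (zero_lt_one.trans_le hq).ne'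
  simp only [integral_norm_rpow_eq hq0 (hf _).1, integral_norm_rpow_eq hq0 hg.1]
  exact (ENNReal.tendsto_toReal (ENNReal.rpow_ne_top_of_nonneg q.2 hg.eLpNorm_ne_top)).comp
    ((tendsto_eLpNorm_of_tendsto_sub (by exact_mod_cast hq) hf hg h).ennrpow_const _)

end Lebesgue

section PolarCoordinates

open Measure Module

variable {E F : Type*} [NormedAddCommGroup E] [NormedSpace ℝ E] [MeasurableSpace E]
  [BorelSpace E] [FiniteDimensional ℝ E] [Nontrivial E] (μ : Measure E) [μ.IsAddHaarMeasure]
  [NormedAddCommGroup F] [NormedSpace ℝ F]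

theorem lintegral_volumeIoiPow (n : ℕ) (f : ℝ → ℝ≥0∞) :
    ∫⁻ r, f r ∂volumeIoiPow n = ∫⁻ r in Ioi (0 : ℝ), ENNReal.ofReal (r ^ n) * f r := by
  rw [volumeIoiPow, lintegral_withDensity_eq_lintegral_mul_non_measurable _ (by fun_prop)
    (by simp)]
  exact lintegral_subtype_comap measurableSet_Ioi fun r => ENNReal.ofReal (r ^ n) * f r

theorem lintegral_polar {f : E → ℝ≥0∞} (hf : Measurable f) :
    ∫⁻ x, f x ∂μ = ∫⁻ θ, (∫⁻ r in Ioi (0 : ℝ),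
      ENNReal.ofReal (r ^ (finrank ℝ E - 1)) * f (r • (θ : E))) ∂μ.toSphere := by
  have hpolar := μ.measurePreserving_homeomorphUnitSphereProd.symm
    (homeomorphUnitSphereProd E).toMeasurableEquiv
  calc ∫⁻ x, f x ∂μ
      = ∫⁻ x : ({0}ᶜ : Set E), f x ∂μ.comap (↑) := by
        rw [lintegral_subtype_comap (measurableSet_singleton 0).compl, restrict_compl_singleton]
    _ = ∫⁻ z, f (z.2.1 • z.1.1) ∂μ.toSphere.prod (volumeIoiPow (finrank ℝ E - 1)) := by
        rw [← hpolar.lintegral_comp (by fun_prop)]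
        rfl
    _ = _ := by
        rw [lintegral_prod _ (by fun_prop)]
        exact lintegral_congr fun θ => lintegral_volumeIoiPow _ fun r => f (r • (θ : E))

theorem lintegral_fun_norm {f : ℝ → ℝ≥0∞} (hf : Measurable f) :
    ∫⁻ x, f ‖x‖ ∂μ = μ.toSphere univ *
      ∫⁻ r in Ioi (0 : ℝ), ENNReal.ofReal (r ^ (finrank ℝ E - 1)) * f r := by
  rw [lintegral_polar μ (by fun_prop), mul_comm, ← lintegral_const]
  refine lintegral_congr fun θ => setLIntegral_congr_fun measurableSet_Ioi fun r hr => ?_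
  simp [norm_smul, abs_of_pos (mem_Ioi.1 hr)]

omit [MeasurableSpace E] [BorelSpace E] [FiniteDimensional ℝ E] [Nontrivial E] in
theorem enorm_le_lintegral_ray [CompleteSpace F] {u : E → F} (hu : ContDiff ℝ 1 u)
    (hc : HasCompactSupport u) (x : E) {θ : E} (hθ : ‖θ‖ = 1) :
    ‖u x‖ₑ ≤ ∫⁻ r in Ioi (0 : ℝ), ‖fderiv ℝ u (x + r • θ)‖ₑ := by
  have hθ0 : θ ≠ 0 := norm_ne_zero_iff.1 (by simp [hθ])
  have hderiv (r : ℝ) : HasDerivAt (fun r : ℝ => u (x + r • θ)) (fderiv ℝ u (x + r • θ) θ) r := by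
    have hray : HasDerivAt (fun r : ℝ => x + r • θ) θ r := by
      simpa using ((hasDerivAt_id r).smul_const θ).const_add x
    exact (hu.differentiable one_ne_zero _).hasFDerivAt.comp_hasDerivAt r hray
  have hcray : HasCompactSupport fun r : ℝ => u (x + r • θ) :=
    hc.comp_isClosedEmbedding ((Homeomorph.addLeft x).isClosedEmbedding.comp
      (isClosedEmbedding_smul_left hθ0))
  have hftc : u x = -∫ r in Ioi (0 : ℝ), fderiv ℝ u (x + r • θ) θ := by
    simpa [(hderiv _).deriv] using
      (congrArg Neg.neg (hcray.integral_Ioi_deriv_eq (by fun_prop) 0)).symm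
  rw [hftc, enorm_neg]
  refine (enorm_integral_le_lintegral_enorm _).trans (lintegral_mono fun r => ?_)
  simpa [← ofReal_norm, hθ] using ContinuousLinearMap.le_opENorm (fderiv ℝ u (x + r • θ)) θ

theorem toSphere_mul_enorm_le_lintegral_fderiv [CompleteSpace F] {u : E → F}
    (hu : ContDiff ℝ 1 u) (hc : HasCompactSupport u) (x : E) :
    μ.toSphere univ * ‖u x‖ₑ
      ≤ ∫⁻ y, ‖fderiv ℝ u y‖ₑ * (‖x - y‖ₑ⁻¹) ^ (finrank ℝ E - 1) ∂μ := by
  have : Continuous (fderiv ℝ u) := hu.continuous_fderiv one_ne_zero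
  have cancel {r : ℝ} (hr : 0 < r) (n : ℕ) (a : ℝ≥0∞) :
      ENNReal.ofReal (r ^ n) * (a * (ENNReal.ofReal r)⁻¹ ^ n) = a := by
    rw [ENNReal.ofReal_pow hr.le, mul_left_comm, ← mul_pow,
      ENNReal.mul_inv_cancel (by simpa) (by simp), one_pow, mul_one]
  calc μ.toSphere univ * ‖u x‖ₑ
      = ∫⁻ _, ‖u x‖ₑ ∂μ.toSphere := by rw [lintegral_const, mul_comm]
    _ ≤ ∫⁻ θ, (∫⁻ r in Ioi (0 : ℝ), ‖fderiv ℝ u (x + r • (θ : E))‖ₑ) ∂μ.toSphere :=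
        lintegral_mono fun θ => enorm_le_lintegral_ray hu hc x (by simp)
    _ = ∫⁻ y, ‖fderiv ℝ u (x + y)‖ₑ * (‖y‖ₑ⁻¹) ^ (finrank ℝ E - 1) ∂μ := by
        rw [lintegral_polar μ (by fun_prop)]
        refine lintegral_congr fun θ => setLIntegral_congr_fun measurableSet_Ioi fun r hr => ?_
        have hnorm : ‖r • (θ : E)‖ₑ = ENNReal.ofReal r := by
          rw [← ofReal_norm, norm_smul]
          simp [abs_of_pos (mem_Ioi.1 hr)]
        rw [hnorm, cancel (mem_Ioi.1 hr)]
    _ = ∫⁻ y, ‖fderiv ℝ u y‖ₑ * (‖x - y‖ₑ⁻¹) ^ (finrank ℝ E - 1) ∂μ := by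
        rw [← lintegral_add_left_eq_self (fun y => ‖fderiv ℝ u y‖ₑ * _) x]
        simp

end PolarCoordinates

section Kernels

open scoped Real

theorem toSphere_univ_R3 : (volume : Measure R3).toSphere univ = ENNReal.ofReal (4 * π) := by
  rw [Measure.toSphere_apply_univ, EuclideanSpace.volume_ball_fin_three, finrank_euclideanSpace_fin,
    ENNReal.ofReal_one, one_pow, one_mul, ← ENNReal.ofReal_natCast, ← ENNReal.ofReal_mul (by simp)]
  congr 1
  push_cast
  ring

theorem lintegral_Ioi_inv_max_sq {d : ℝ} (hd : 0 < d) :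
    ∫⁻ r in Ioi (0 : ℝ), ENNReal.ofReal ((max d r)⁻¹ ^ 2) = ENNReal.ofReal (2 / d) := by
  have near : ∫⁻ r in Ioc 0 d, ENNReal.ofReal ((max d r)⁻¹ ^ 2) = ENNReal.ofReal d⁻¹ := by
    rw [setLIntegral_congr_fun (g := fun _ => ENNReal.ofReal (d⁻¹ ^ 2)) measurableSet_Ioc
      fun r hr => by simp [hr.2], setLIntegral_const, Real.volume_Ioc,
      ← ENNReal.ofReal_mul (by positivity)]
    congr 1
    field_simp
    ring
  have far : ∫⁻ r in Ioi d, ENNReal.ofReal ((max d r)⁻¹ ^ 2) = ENNReal.ofReal d⁻¹ := by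
    have inv_sq : EqOn (fun r => (max d r)⁻¹ ^ 2) (fun r => r ^ (-2 : ℝ)) (Ioi d) := fun r hr => by
      simp only [max_eq_right (le_of_lt (mem_Ioi.1 hr)),
        Real.rpow_neg (hd.trans (mem_Ioi.1 hr)).le, inv_pow]
      norm_cast
    rw [← ofReal_integral_eq_lintegral_ofReal
      ((integrableOn_Ioi_rpow_of_lt (by norm_num) hd).congr_fun inv_sq.symm measurableSet_Ioi)
      (ae_of_all _ fun r => by positivity), setIntegral_congr_fun measurableSet_Ioi inv_sq,
      integral_Ioi_rpow_of_lt (by norm_num) hd]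
    norm_num [Real.rpow_neg_one]
  rw [← Ioc_union_Ioi_eq_Ioi hd.le, lintegral_union measurableSet_Ioi (Ioc_disjoint_Ioi le_rfl),
    near, far, ← ENNReal.ofReal_add (by positivity) (by positivity)]
  congr 1
  ring

theorem lintegral_inv_enorm_mul_inv_max_sq {d : ℝ} (hd : 0 < d) :
    ∫⁻ y : R3, (‖y‖ₑ⁻¹ * (max (ENNReal.ofReal d) ‖y‖ₑ)⁻¹) ^ 2 = ENNReal.ofReal (8 * π / d) := by
  have cancel {r : ℝ} (hr : 0 < r) : ENNReal.ofReal (r ^ 2) *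
      ((ENNReal.ofReal r)⁻¹ * (max (ENNReal.ofReal d) (ENNReal.ofReal r))⁻¹) ^ 2
        = ENNReal.ofReal ((max d r)⁻¹ ^ 2) := by
    have hmax : 0 < max d r := hd.trans_le (le_max_left _ _)
    rw [← ENNReal.ofReal_max, ← ENNReal.ofReal_inv_of_pos hr, ← ENNReal.ofReal_inv_of_pos hmax,
      ← ENNReal.ofReal_mul (by positivity), ← ENNReal.ofReal_pow (by positivity),
      ← ENNReal.ofReal_mul (by positivity)]
    congr 1
    field_simp
  simp only [← ofReal_norm]
  rw [lintegral_fun_norm volume (f := fun s => ((ENNReal.ofReal s)⁻¹ *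
      (max (ENNReal.ofReal d) (ENNReal.ofReal s))⁻¹) ^ 2) (by fun_prop), finrank_euclideanSpace_fin,
    setLIntegral_congr_fun measurableSet_Ioi fun r hr => cancel (mem_Ioi.1 hr),
    lintegral_Ioi_inv_max_sq hd, toSphere_univ_R3, ← ENNReal.ofReal_mul (by positivity)]
  congr 1
  ring

theorem inv_mul_inv_sq_le {d a b : ℝ≥0∞} (h : d ≤ a + b) :
    (a⁻¹ * b⁻¹) ^ 2 ≤ 4 * ((a⁻¹ * (max d a)⁻¹) ^ 2 + (b⁻¹ * (max d b)⁻¹) ^ 2) := by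
  wlog hab : a ≤ b generalizing a b
  · simpa only [mul_comm, add_comm] using this (add_comm a b ▸ h) (le_of_not_ge hab)
  have hmax : max d a ≤ 2 * b :=
    max_le (h.trans (by rw [two_mul]; gcongr)) (hab.trans (le_mul_of_one_le_left' one_le_two))
  have hb : b⁻¹ ≤ 2 * (max d a)⁻¹ := by
    calc b⁻¹ = 2 * (2 * b)⁻¹ := by
          rw [ENNReal.mul_inv (by simp) (by simp), ← mul_assoc,
            ENNReal.mul_inv_cancel (by simp) (by simp), one_mul]
      _ ≤ 2 * (max d a)⁻¹ := by gcongr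
  calc (a⁻¹ * b⁻¹) ^ 2 ≤ (a⁻¹ * (2 * (max d a)⁻¹)) ^ 2 := by gcongr
    _ = 4 * (a⁻¹ * (max d a)⁻¹) ^ 2 := by ring
    _ ≤ _ := by gcongr; exact le_self_add

theorem lintegral_inv_sq_mul_inv_sq_le (x z : R3) :
    ∫⁻ y, (‖x - y‖ₑ⁻¹ * ‖z - y‖ₑ⁻¹) ^ 2 ≤ ENNReal.ofReal (64 * π) * ‖x - z‖ₑ⁻¹ := by
  rcases eq_or_ne x z with rfl | hxz
  · simp [Real.pi_pos]
  have hd : 0 < ‖x - z‖ := norm_pos_iff.2 (sub_ne_zero.2 hxz)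
  let k (w : R3) : ℝ≥0∞ := (‖w‖ₑ⁻¹ * (max (ENNReal.ofReal ‖x - z‖) ‖w‖ₑ)⁻¹) ^ 2
  have hk : Measurable k := by fun_prop
  have bound (y : R3) : (‖x - y‖ₑ⁻¹ * ‖z - y‖ₑ⁻¹) ^ 2 ≤ 4 * (k (x - y) + k (z - y)) := by
    refine inv_mul_inv_sq_le ?_
    rw [ofReal_norm]
    simpa using enorm_sub_le (a := x - y) (b := z - y)
  calc ∫⁻ y, (‖x - y‖ₑ⁻¹ * ‖z - y‖ₑ⁻¹) ^ 2
      ≤ ∫⁻ y, 4 * (k (x - y) + k (z - y)) := lintegral_mono bound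
    _ = 4 * ((∫⁻ w, k w) + ∫⁻ w, k w) := by
        rw [lintegral_const_mul' _ _ (by simp), lintegral_add_left (by fun_prop),
          lintegral_sub_left_eq_self, lintegral_sub_left_eq_self]
    _ = ENNReal.ofReal (64 * π) * ‖x - z‖ₑ⁻¹ := by
        rw [lintegral_inv_enorm_mul_inv_max_sq hd, ← ofReal_norm, ← ENNReal.ofReal_inv_of_pos hd,
          ← ENNReal.ofReal_add (by positivity) (by positivity), ← ENNReal.ofReal_ofNat,
          ← ENNReal.ofReal_mul (by positivity), ← ENNReal.ofReal_mul (by positivity)]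
        congr 1
        ring

theorem mul_inv_le_add_sq_add (a r : ℝ≥0∞) :
    a * r⁻¹ ≤ a + a ^ 2 + (r⁻¹ * (max 1 r)⁻¹) ^ 2 := by
  rcases le_total 1 r with hr | hr
  · refine le_add_right (le_add_right ?_)
    exact mul_le_of_le_one_right' (ENNReal.inv_le_one.2 hr)
  rw [max_eq_left hr, inv_one, mul_one, sq, sq]
  rcases le_total a r⁻¹ with har | har
  · exact le_add_left (by gcongr)
  · exact le_add_right (le_add_left (by gcongr))

theorem lintegral_sq_mul_inv_le {u : R3 → ℝ} (hu : AEStronglyMeasurable u) (x : R3) :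
    ∫⁻ y, ‖u y‖ₑ ^ 2 * ‖x - y‖ₑ⁻¹
      ≤ (∫⁻ y, ‖u y‖ₑ ^ 2) + (∫⁻ y, ‖u y‖ₑ ^ 4) + ENNReal.ofReal (8 * π) := by
  have hu2 : AEMeasurable fun y => ‖u y‖ₑ ^ 2 := hu.enorm.pow_const _
  have : AEMeasurable fun y => (‖u y‖ₑ ^ 2) ^ 2 := hu2.pow_const _
  calc ∫⁻ y, ‖u y‖ₑ ^ 2 * ‖x - y‖ₑ⁻¹
      ≤ ∫⁻ y, (‖u y‖ₑ ^ 2 + (‖u y‖ₑ ^ 2) ^ 2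
          + (‖x - y‖ₑ⁻¹ * (max 1 ‖x - y‖ₑ)⁻¹) ^ 2) :=
        lintegral_mono fun y => mul_inv_le_add_sq_add _ _
    _ = _ := by
        rw [lintegral_add_right _ (by fun_prop), lintegral_add_left' hu2,
          lintegral_sub_left_eq_self
            (fun w : R3 => (‖w‖ₑ⁻¹ * (max 1 ‖w‖ₑ)⁻¹) ^ 2) x, ← ENNReal.ofReal_one,
          lintegral_inv_enorm_mul_inv_max_sq one_pos]
        simp only [← pow_mul, div_one]

end Kernels

/-- The mutual Coulomb energy of two nonnegative charge densities. Unlike in `coulombIntegrand`,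
the kernel `‖x - y‖ₑ⁻¹` is infinite on the (null) diagonal. -/
def coulombPairing (f g : R3 → ℝ≥0∞) : ℝ≥0∞ :=
  ∫⁻ x, ∫⁻ y, f x * g y * ‖x - y‖ₑ⁻¹

/-- The Coulomb energy of the charge density `u²`, as an extended nonnegative number. -/
def coulombEnergy (u : R3 → ℝ) : ℝ≥0∞ :=
  coulombPairing (fun x => ‖u x‖ₑ ^ 2) fun x => ‖u x‖ₑ ^ 2

section CoulombSobolev

open scoped Real

theorem coulombPairing_comm {f g : R3 → ℝ≥0∞} (hf : AEMeasurable f) (hg : AEMeasurable g) :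
    coulombPairing f g = coulombPairing g f := by
  have hmeas : AEMeasurable (Function.uncurry fun x y : R3 => f x * g y * ‖x - y‖ₑ⁻¹)
      (volume.prod volume) :=
    (hf.comp_fst.mul hg.comp_snd).mul (by fun_prop)
  rw [coulombPairing, lintegral_lintegral_swap hmeas, coulombPairing]
  simp only [mul_comm (f _) (g _), enorm_sub_rev]

theorem coulombPairing_add_left {f₁ f₂ g : R3 → ℝ≥0∞} (hf₁ : AEMeasurable f₁)
    (hg : AEMeasurable g) :
    coulombPairing (f₁ + f₂) g = coulombPairing f₁ g + coulombPairing f₂ g := by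
  have hmeas (x : R3) : AEMeasurable fun y => f₁ x * g y * ‖x - y‖ₑ⁻¹ :=
    (hg.const_mul _).mul (by fun_prop)
  have hmeas' : AEMeasurable (fun z : R3 × R3 => f₁ z.1 * g z.2 * ‖z.1 - z.2‖ₑ⁻¹)
      (volume.prod volume) :=
    (hf₁.comp_fst.mul hg.comp_snd).mul (by fun_prop)
  simp only [coulombPairing, Pi.add_apply, add_mul, lintegral_add_left' (hmeas _)]
  exact lintegral_add_left' hmeas'.lintegral_prod_right' _

theorem coulombPairing_add_right {f g₁ g₂ : R3 → ℝ≥0∞} (hf : AEMeasurable f)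
    (hg₁ : AEMeasurable g₁) (hg₂ : AEMeasurable g₂) :
    coulombPairing f (g₁ + g₂) = coulombPairing f g₁ + coulombPairing f g₂ := by
  rw [coulombPairing_comm hf (hg₁.add hg₂), coulombPairing_add_left hg₁ hf,
    coulombPairing_comm hg₁ hf, coulombPairing_comm hg₂ hf]

theorem coulombPairing_le_of_potential_le {f g : R3 → ℝ≥0∞} {C : ℝ≥0∞} (hf : AEMeasurable f)
    (hg : AEMeasurable g) (hC : ∀ x, ∫⁻ y, g y * ‖x - y‖ₑ⁻¹ ≤ C) :
    coulombPairing f g ≤ (∫⁻ x, f x) * C := by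
  rw [← lintegral_mul_const'' _ hf]
  refine lintegral_mono fun x => ?_
  simp only [mul_assoc]
  have hmeas : AEMeasurable fun y => g y * ‖x - y‖ₑ⁻¹ := hg.mul (by fun_prop)
  rw [lintegral_const_mul'' _ hmeas]
  gcongr
  exact hC x

theorem lintegral_sq_lintegral_mul_inv_sq_le {f : R3 → ℝ≥0∞} (hf : Measurable f) :
    ∫⁻ y, (∫⁻ x, f x * ‖x - y‖ₑ⁻¹ ^ 2) ^ 2 ≤ ENNReal.ofReal (64 * π) * coulombPairing f f := by
  have expand (y : R3) : (∫⁻ x, f x * ‖x - y‖ₑ⁻¹ ^ 2) ^ 2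
      = ∫⁻ x, ∫⁻ z, f x * f z * (‖x - y‖ₑ⁻¹ * ‖z - y‖ₑ⁻¹) ^ 2 := by
    rw [sq, ← lintegral_mul_const _ (by fun_prop)]
    refine lintegral_congr fun x => ?_
    rw [← lintegral_const_mul _ (by fun_prop)]
    exact lintegral_congr fun z => by ring
  calc ∫⁻ y, (∫⁻ x, f x * ‖x - y‖ₑ⁻¹ ^ 2) ^ 2
      = ∫⁻ y, ∫⁻ x, ∫⁻ z, f x * f z * (‖x - y‖ₑ⁻¹ * ‖z - y‖ₑ⁻¹) ^ 2 := lintegral_congr expand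
    _ = ∫⁻ x, ∫⁻ y, ∫⁻ z, f x * f z * (‖x - y‖ₑ⁻¹ * ‖z - y‖ₑ⁻¹) ^ 2 :=
        lintegral_lintegral_swap (by fun_prop)
    _ = ∫⁻ x, ∫⁻ z, ∫⁻ y, f x * f z * (‖x - y‖ₑ⁻¹ * ‖z - y‖ₑ⁻¹) ^ 2 :=
        lintegral_congr fun x => lintegral_lintegral_swap (by fun_prop)
    _ ≤ ∫⁻ x, ∫⁻ z, f x * f z * (ENNReal.ofReal (64 * π) * ‖x - z‖ₑ⁻¹) := by
        gcongr with x z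
        rw [lintegral_const_mul _ (by fun_prop)]
        gcongr
        exact lintegral_inv_sq_mul_inv_sq_le x z
    _ = ENNReal.ofReal (64 * π) * coulombPairing f f := by
        simp only [coulombPairing, mul_left_comm _ (ENNReal.ofReal (64 * π)),
          lintegral_const_mul' _ _ ENNReal.ofReal_ne_top]

theorem lintegral_mul_enorm_le_lintegral_fderiv {u : R3 → ℝ} (hu : ContDiff ℝ 1 u)
    (hc : HasCompactSupport u) {f : R3 → ℝ≥0∞} (hf : Measurable f) :
    ENNReal.ofReal (4 * π) * ∫⁻ x, f x * ‖u x‖ₑ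
      ≤ ∫⁻ y, ‖fderiv ℝ u y‖ₑ * ∫⁻ x, f x * ‖x - y‖ₑ⁻¹ ^ 2 := by
  have : Continuous (fderiv ℝ u) := hu.continuous_fderiv one_ne_zero
  have riesz (x : R3) : ENNReal.ofReal (4 * π) * ‖u x‖ₑ
      ≤ ∫⁻ y, ‖fderiv ℝ u y‖ₑ * ‖x - y‖ₑ⁻¹ ^ 2 := by
    simpa only [toSphere_univ_R3, finrank_euclideanSpace_fin, Nat.reduceSub] using
      toSphere_mul_enorm_le_lintegral_fderiv volume hu hc x
  calc ENNReal.ofReal (4 * π) * ∫⁻ x, f x * ‖u x‖ₑ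
      = ∫⁻ x, f x * (ENNReal.ofReal (4 * π) * ‖u x‖ₑ) := by
        simp only [mul_left_comm (f _)]
        rw [lintegral_const_mul' _ _ ENNReal.ofReal_ne_top]
    _ ≤ ∫⁻ x, f x * ∫⁻ y, ‖fderiv ℝ u y‖ₑ * ‖x - y‖ₑ⁻¹ ^ 2 := by gcongr with x; exact riesz x
    _ = ∫⁻ x, ∫⁻ y, ‖fderiv ℝ u y‖ₑ * (f x * ‖x - y‖ₑ⁻¹ ^ 2) := by
        refine lintegral_congr fun x => ?_
        rw [← lintegral_const_mul _ (by fun_prop)]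
        simp only [mul_left_comm (f x)]
    _ = ∫⁻ y, ∫⁻ x, ‖fderiv ℝ u y‖ₑ * (f x * ‖x - y‖ₑ⁻¹ ^ 2) :=
        lintegral_lintegral_swap (by fun_prop)
    _ = ∫⁻ y, ‖fderiv ℝ u y‖ₑ * ∫⁻ x, f x * ‖x - y‖ₑ⁻¹ ^ 2 := by
        simp only [lintegral_const_mul' _ _ enorm_ne_top]

theorem sq_lintegral_enorm_pow_three_le {u : R3 → ℝ} (hu : ContDiff ℝ 1 u)
    (hc : HasCompactSupport u) :
    (∫⁻ x, ‖u x‖ₑ ^ 3) ^ 2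
      ≤ ENNReal.ofReal (4 / π) * ((∫⁻ x, ‖fderiv ℝ u x‖ₑ ^ 2) * coulombEnergy u) := by
  have : Continuous (fderiv ℝ u) := hu.continuous_fderiv one_ne_zero
  have hsq : Measurable fun x => ‖u x‖ₑ ^ 2 := hu.continuous.measurable.enorm.pow_const 2
  have hscaled : (ENNReal.ofReal (4 * π) * ∫⁻ x, ‖u x‖ₑ ^ 3) ^ 2
      ≤ (∫⁻ x, ‖fderiv ℝ u x‖ₑ ^ 2) * (ENNReal.ofReal (64 * π) * coulombEnergy u) := by
    calc (ENNReal.ofReal (4 * π) * ∫⁻ x, ‖u x‖ₑ ^ 3) ^ 2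
        ≤ (∫⁻ y, ‖fderiv ℝ u y‖ₑ * ∫⁻ x, ‖u x‖ₑ ^ 2 * ‖x - y‖ₑ⁻¹ ^ 2) ^ 2 := by
          gcongr
          simpa only [← pow_succ] using lintegral_mul_enorm_le_lintegral_fderiv hu hc hsq
      _ ≤ (∫⁻ y, ‖fderiv ℝ u y‖ₑ ^ 2) * ∫⁻ y, (∫⁻ x, ‖u x‖ₑ ^ 2 * ‖x - y‖ₑ⁻¹ ^ 2) ^ 2 :=
          sq_lintegral_mul_le (by fun_prop) (by fun_prop)
      _ ≤ _ := by
          gcongr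
          exact lintegral_sq_lintegral_mul_inv_sq_le hsq
  have hconst : ENNReal.ofReal (4 * π) ^ 2 * ENNReal.ofReal (4 / π) = ENNReal.ofReal (64 * π) := by
    rw [← ENNReal.ofReal_pow (by positivity), ← ENNReal.ofReal_mul (by positivity)]
    congr 1
    field_simp
    norm_num
  have hpos : ENNReal.ofReal (4 * π) ^ 2 ≠ 0 := by simp [Real.pi_pos]
  rw [mul_pow, mul_left_comm, ← hconst, mul_assoc] at hscaled
  exact (ENNReal.mul_le_mul_iff_right hpos (by simp [ENNReal.mul_eq_top])).1 hscaled

end CoulombSobolev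

section CoulombEnergy

open scoped Real

/-- A uniform bound for the Coulomb potential of the charge density `u²`. -/
def potentialBound (u : R3 → ℝ) : ℝ≥0∞ :=
  eLpNorm u 2 ^ 2 + eLpNorm u 4 ^ 4 + ENNReal.ofReal (8 * π)

theorem potentialBound_ne_top {u : R3 → ℝ} (h2 : MemLp u 2) (h4 : MemLp u 4) :
    potentialBound u ≠ ⊤ := by
  simp only [potentialBound, ne_eq, ENNReal.add_eq_top, ENNReal.pow_eq_top_iff,
    h2.eLpNorm_ne_top, h4.eLpNorm_ne_top, ENNReal.ofReal_ne_top, false_and, or_self,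
    not_false_eq_true]

theorem coulombPairing_sq_le {f : R3 → ℝ≥0∞} (hf : AEMeasurable f) {u : R3 → ℝ}
    (hu : AEStronglyMeasurable u) :
    coulombPairing f (fun x => ‖u x‖ₑ ^ 2) ≤ (∫⁻ x, f x) * potentialBound u := by
  refine coulombPairing_le_of_potential_le hf (hu.enorm.pow_const 2) fun x => ?_
  rw [potentialBound]
  simpa only [lintegral_enorm_pow_eq two_ne_zero, lintegral_enorm_pow_eq four_ne_zero,
    Nat.cast_ofNat] using lintegral_sq_mul_inv_le hu x

theorem coulombEnergy_ne_top {u : R3 → ℝ} (h2 : MemLp u 2) (h4 : MemLp u 4) :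
    coulombEnergy u ≠ ⊤ := by
  refine ne_top_of_le_ne_top (ENNReal.mul_ne_top ?_ (potentialBound_ne_top h2 h4))
    (coulombPairing_sq_le (h2.1.enorm.pow_const 2) h2.1)
  rw [lintegral_enorm_pow_eq two_ne_zero]
  simp [h2.eLpNorm_ne_top]

theorem aestronglyMeasurable_coulombIntegrand {u : R3 → ℝ} (hu : AEStronglyMeasurable u) :
    AEStronglyMeasurable (fun z : R3 × R3 => coulombIntegrand u z.1 z.2)
      (volume.prod volume) :=
  (((hu.aemeasurable.comp_fst.pow_const 2).mul (hu.aemeasurable.comp_snd.pow_const 2)).div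
    (by fun_prop)).aestronglyMeasurable

theorem enorm_mul_div_norm {a b : ℝ} {x y : R3} (h : x ≠ y) :
    ‖a * b / ‖x - y‖‖ₑ = ‖a‖ₑ * ‖b‖ₑ * ‖x - y‖ₑ⁻¹ := by
  rw [div_eq_mul_inv, enorm_mul, enorm_mul, enorm_inv (by simpa [sub_eq_zero]), enorm_norm]

theorem lintegral_enorm_coulombIntegrand {u : R3 → ℝ} (hu : AEStronglyMeasurable u) :
    ∫⁻ z : R3 × R3, ‖coulombIntegrand u z.1 z.2‖ₑ ∂volume.prod volume = coulombEnergy u := by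
  rw [lintegral_prod _ (aestronglyMeasurable_coulombIntegrand hu).enorm, coulombEnergy,
    coulombPairing]
  refine lintegral_congr fun x => lintegral_congr_ae ?_
  filter_upwards [Measure.ae_ne volume x] with y hyx
  rw [coulombIntegrand, enorm_mul_div_norm hyx.symm, enorm_pow, enorm_pow]

theorem integrable_coulombIntegrand {u : R3 → ℝ} (h2 : MemLp u 2) (h4 : MemLp u 4) :
    Integrable (fun z : R3 × R3 => coulombIntegrand u z.1 z.2) (volume.prod volume) := by
  refine ⟨aestronglyMeasurable_coulombIntegrand h2.1, ?_⟩
  rw [hasFiniteIntegral_iff_enorm, lintegral_enorm_coulombIntegrand h2.1]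
  exact (coulombEnergy_ne_top h2 h4).lt_top

theorem integral_coulombIntegrand {u : R3 → ℝ} (h2 : MemLp u 2) (h4 : MemLp u 4) :
    ∫ x, ∫ y, coulombIntegrand u x y = (coulombEnergy u).toReal := by
  have hnonneg (z : R3 × R3) : 0 ≤ coulombIntegrand u z.1 z.2 := by
    unfold coulombIntegrand; positivity
  rw [← lintegral_enorm_coulombIntegrand h2.1,
    ← integral_prod (fun z : R3 × R3 => coulombIntegrand u z.1 z.2)
      (integrable_coulombIntegrand h2 h4),
    ← integral_norm_eq_lintegral_enorm (aestronglyMeasurable_coulombIntegrand h2.1)]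
  simp only [Real.norm_of_nonneg (hnonneg _)]

theorem enorm_coulombIntegrand_sub_le (u v : R3 → ℝ) {x y : R3} (hxy : x ≠ y) :
    ‖coulombIntegrand v x y - coulombIntegrand u x y‖ₑ
      ≤ ‖v x ^ 2 - u x ^ 2‖ₑ * ‖v y‖ₑ ^ 2 * ‖x - y‖ₑ⁻¹
        + ‖v y ^ 2 - u y ^ 2‖ₑ * ‖u x‖ₑ ^ 2 * ‖x - y‖ₑ⁻¹ := by
  have hsplit : coulombIntegrand v x y - coulombIntegrand u x y
      = (v x ^ 2 - u x ^ 2) * v y ^ 2 / ‖x - y‖ + (v y ^ 2 - u y ^ 2) * u x ^ 2 / ‖x - y‖ := by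
    unfold coulombIntegrand
    ring
  rw [hsplit, ← enorm_pow, ← enorm_pow, ← enorm_mul_div_norm hxy, ← enorm_mul_div_norm hxy]
  exact enorm_add_le _ _

theorem lintegral_enorm_coulombIntegrand_sub_le {u v : R3 → ℝ} (hu : AEStronglyMeasurable u)
    (hv : AEStronglyMeasurable v) :
    ∫⁻ z : R3 × R3, ‖coulombIntegrand v z.1 z.2 - coulombIntegrand u z.1 z.2‖ₑ
      ∂volume.prod volume
      ≤ (∫⁻ x, ‖v x ^ 2 - u x ^ 2‖ₑ) * (potentialBound v + potentialBound u) := by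
  let δ (x : R3) : ℝ≥0∞ := ‖v x ^ 2 - u x ^ 2‖ₑ
  let V (x : R3) : ℝ≥0∞ := ‖v x‖ₑ ^ 2
  let U (x : R3) : ℝ≥0∞ := ‖u x‖ₑ ^ 2
  have hδ : AEMeasurable δ := ((hv.pow 2).sub (hu.pow 2)).enorm
  have hU : AEMeasurable U := hu.enorm.pow_const 2
  have hV : AEMeasurable V := hv.enorm.pow_const 2
  have hmeas : AEMeasurable (fun z : R3 × R3 => δ z.1 * V z.2 * ‖z.1 - z.2‖ₑ⁻¹)
      (volume.prod volume) := (hδ.comp_fst.mul hV.comp_snd).mul (by fun_prop)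
  have hmeas' (x : R3) : AEMeasurable fun y => δ x * V y * ‖x - y‖ₑ⁻¹ :=
    (hV.const_mul _).mul (by fun_prop)
  calc ∫⁻ z : R3 × R3, ‖coulombIntegrand v z.1 z.2 - coulombIntegrand u z.1 z.2‖ₑ
        ∂volume.prod volume
      = ∫⁻ x, ∫⁻ y, ‖coulombIntegrand v x y - coulombIntegrand u x y‖ₑ :=
        lintegral_prod _ ((aestronglyMeasurable_coulombIntegrand hv).sub
          (aestronglyMeasurable_coulombIntegrand hu)).enorm
    _ ≤ ∫⁻ x, ∫⁻ y, (δ x * V y * ‖x - y‖ₑ⁻¹ + U x * δ y * ‖x - y‖ₑ⁻¹) := by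
        refine lintegral_mono fun x => lintegral_mono_ae ?_
        filter_upwards [Measure.ae_ne volume x] with y hyx
        simpa only [mul_comm (U x)] using enorm_coulombIntegrand_sub_le u v hyx.symm
    _ = coulombPairing δ V + coulombPairing U δ := by
        simp only [lintegral_add_left' (hmeas' _)]
        exact lintegral_add_left' hmeas.lintegral_prod_right' _
    _ ≤ (∫⁻ x, δ x) * potentialBound v + (∫⁻ x, δ x) * potentialBound u := by
        rw [coulombPairing_comm hU hδ]
        gcongr
        exacts [coulombPairing_sq_le hδ hv, coulombPairing_sq_le hδ hu]
    _ = (∫⁻ x, δ x) * (potentialBound v + potentialBound u) := (mul_add _ _ _).symm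

theorem lintegral_enorm_sq_sub_sq_le {u v : R3 → ℝ} (hu : AEStronglyMeasurable u)
    (hv : AEStronglyMeasurable v) :
    (∫⁻ x, ‖v x ^ 2 - u x ^ 2‖ₑ) ^ 2 ≤ eLpNorm (v + u) 2 ^ 2 * eLpNorm (v - u) 2 ^ 2 := by
  calc (∫⁻ x, ‖v x ^ 2 - u x ^ 2‖ₑ) ^ 2
      = (∫⁻ x, ‖(v + u) x‖ₑ * ‖(v - u) x‖ₑ) ^ 2 := by
        simp only [sq_sub_sq, enorm_mul, Pi.add_apply, Pi.sub_apply]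
    _ ≤ (∫⁻ x, ‖(v + u) x‖ₑ ^ 2) * ∫⁻ x, ‖(v - u) x‖ₑ ^ 2 :=
        sq_lintegral_mul_le (hv.add hu).enorm (hv.sub hu).enorm
    _ = _ := by simp only [lintegral_enorm_pow_eq two_ne_zero, Nat.cast_ofNat]

theorem tendsto_lintegral_enorm_sq_sub_sq {ι : Type*} {l : Filter ι} {v : ι → R3 → ℝ}
    {u : R3 → ℝ} (hv : ∀ i, MemLp (v i) 2) (hu : MemLp u 2)
    (h : Tendsto (fun i => eLpNorm (v i - u) 2) l (𝓝 0)) :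
    Tendsto (fun i => ∫⁻ x, ‖v i x ^ 2 - u x ^ 2‖ₑ) l (𝓝 0) := by
  have hsum : Tendsto (fun i => eLpNorm (v i + u) 2) l (𝓝 (eLpNorm (u + u) 2)) :=
    tendsto_eLpNorm_of_tendsto_sub one_le_two (fun i => (hv i).add hu) (hu.add hu)
      (by simpa only [add_sub_add_right_eq_sub] using h)
  have hprod : Tendsto (fun i => eLpNorm (v i + u) 2 * eLpNorm (v i - u) 2) l (𝓝 0) := by
    simpa using ENNReal.Tendsto.mul hsum (Or.inr ENNReal.zero_ne_top) h
      (Or.inr (hu.add hu).eLpNorm_ne_top)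
  refine tendsto_of_tendsto_of_tendsto_of_le_of_le tendsto_const_nhds hprod
    (fun _ => zero_le) fun i => ?_
  rw [← ENNReal.pow_le_pow_left_iff two_ne_zero, mul_pow]
  exact lintegral_enorm_sq_sub_sq_le hu.1 (hv i).1

theorem tendsto_toReal_coulombEnergy {ι : Type*} {l : Filter ι} {v : ι → R3 → ℝ} {u : R3 → ℝ}
    (hv2 : ∀ i, MemLp (v i) 2) (hv4 : ∀ i, MemLp (v i) 4) (hu2 : MemLp u 2) (hu4 : MemLp u 4)
    (h2 : Tendsto (fun i => eLpNorm (v i - u) 2) l (𝓝 0))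
    (h4 : Tendsto (fun i => eLpNorm (v i - u) 4) l (𝓝 0)) :
    Tendsto (fun i => (coulombEnergy (v i)).toReal) l (𝓝 (coulombEnergy u).toReal) := by
  have hbound : Tendsto (fun i => potentialBound (v i)) l (𝓝 (potentialBound u)) :=
    ((ENNReal.Tendsto.pow (tendsto_eLpNorm_of_tendsto_sub one_le_two hv2 hu2 h2)).add
      (ENNReal.Tendsto.pow (tendsto_eLpNorm_of_tendsto_sub (by norm_num) hv4 hu4 h4))).add_const _
  have hprod : Tendsto (fun i => (∫⁻ x, ‖v i x ^ 2 - u x ^ 2‖ₑ)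
      * (potentialBound (v i) + potentialBound u)) l (𝓝 0) := by
    simpa [potentialBound_ne_top hu2 hu4] using
      ENNReal.Tendsto.mul (tendsto_lintegral_enorm_sq_sub_sq hv2 hu2 h2)
        (Or.inr (by simp [potentialBound_ne_top hu2 hu4])) (hbound.add_const (potentialBound u))
        (Or.inr ENNReal.zero_ne_top)
  have hL1 := tendsto_of_tendsto_of_tendsto_of_le_of_le tendsto_const_nhds hprod
    (fun _ => zero_le) fun i => lintegral_enorm_coulombIntegrand_sub_le hu2.1 (hv2 i).1
  simp only [← integral_coulombIntegrand hu2 hu4, ← integral_coulombIntegrand (hv2 _) (hv4 _)]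
  simp only [← integral_prod _ (integrable_coulombIntegrand hu2 hu4),
    ← integral_prod _ (integrable_coulombIntegrand (hv2 _) (hv4 _))]
  exact tendsto_integral_of_L1 _ (aestronglyMeasurable_coulombIntegrand hu2.1)
    (Eventually.of_forall fun i => integrable_coulombIntegrand (hv2 i) (hv4 i)) hL1

end CoulombEnergy

section Mollification

variable {E : Type*} [NormedAddCommGroup E] [InnerProductSpace ℝ E]

/-- A function of a vector is radial if it depends only on the norm of that vector. -/
def IsRadial {α : Type*} (u : E → α) : Prop :=
  ∀ x y, ‖x‖ = ‖y‖ → u x = u y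

/-- A smooth radial cutoff at scale `1 / r`: it is `1` where `‖r • x‖ ≤ 1` and `0` where
`2 < ‖r • x‖`. -/
def cutoff (r : ℝ) (x : E) : ℝ :=
  Real.smoothTransition (2 - ‖r • x‖ ^ 2)

theorem contDiff_cutoff (r : ℝ) : ContDiff ℝ ∞ (cutoff r : E → ℝ) :=
  Real.smoothTransition.contDiff.comp
    (contDiff_const.sub ((contDiff_norm_sq ℝ).comp (contDiff_const_smul r)))

theorem cutoff_nonneg (r : ℝ) (x : E) : 0 ≤ cutoff r x := Real.smoothTransition.nonneg _

theorem cutoff_le_one (r : ℝ) (x : E) : cutoff r x ≤ 1 := Real.smoothTransition.le_one _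

theorem enorm_cutoff_le_one (r : ℝ) (x : E) : ‖cutoff r x‖ₑ ≤ 1 := by
  rw [Real.enorm_eq_ofReal (cutoff_nonneg r x), ENNReal.ofReal_le_one]
  exact cutoff_le_one r x

theorem cutoff_eq_one {r : ℝ} {x : E} (h : ‖r • x‖ ≤ 1) : cutoff r x = 1 :=
  Real.smoothTransition.one_of_one_le (by nlinarith [norm_nonneg (r • x)])

theorem cutoff_eq_zero {r : ℝ} {x : E} (h : 2 < ‖r • x‖) : cutoff r x = 0 :=
  Real.smoothTransition.zero_of_nonpos (by nlinarith)

theorem isRadial_cutoff (r : ℝ) : IsRadial (cutoff r : E → ℝ) := fun x y h => by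
  simp [cutoff, norm_smul, h]

theorem cutoff_eq_zero_of_lt_norm {r : ℝ} (hr : 0 < r) {x : E} (h : 2 / r < ‖x‖) :
    cutoff r x = 0 := by
  apply cutoff_eq_zero
  rwa [norm_smul, Real.norm_of_nonneg hr.le, ← div_lt_iff₀' hr]

variable [FiniteDimensional ℝ E]

theorem hasCompactSupport_of_lt_norm {v : E → ℝ} {R : ℝ} (h : ∀ x, R < ‖x‖ → v x = 0) :
    HasCompactSupport v :=
  HasCompactSupport.intro (isCompact_closedBall (0 : E) R) fun x hx => h x (by simpa using hx)

theorem hasCompactSupport_cutoff {r : ℝ} (hr : 0 < r) : HasCompactSupport (cutoff r : E → ℝ) :=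
  hasCompactSupport_of_lt_norm fun _ => cutoff_eq_zero_of_lt_norm hr

theorem exists_norm_fderiv_cutoff_le :
    ∃ C : ℝ, ∀ (r : ℝ) (x : E), ‖fderiv ℝ (cutoff r) x‖ ≤ C * |r| := by
  obtain ⟨C, hC⟩ := ((hasCompactSupport_cutoff (E := E) one_pos).fderiv
    (𝕜 := ℝ)).exists_bound_of_continuous ((contDiff_cutoff 1).continuous_fderiv (by simp))
  refine ⟨C, fun r x => ?_⟩
  have hscale : (cutoff r : E → ℝ) = fun x => cutoff 1 (r • x) := by
    simp [funext_iff, cutoff]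
  rw [hscale, fderiv_comp_smul, norm_smul, mul_comm C, Real.norm_eq_abs]
  gcongr
  exact hC _

theorem norm_gradient (v : E → ℝ) (x : E) : ‖gradient v x‖ = ‖fderiv ℝ v x‖ := by
  simp [gradient]

theorem continuous_gradient {v : E → ℝ} (hv : ContDiff ℝ 1 v) : Continuous (gradient v) :=
  (InnerProductSpace.toDual ℝ E).symm.continuous.comp (hv.continuous_fderiv one_ne_zero)

theorem gradient_mul {a b : E → ℝ} (ha : Differentiable ℝ a) (hb : Differentiable ℝ b) :
    gradient (a * b) = a • gradient b + b • gradient a := by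
  ext1 x
  simp [gradient, fderiv_mul (ha x) (hb x)]

variable [MeasurableSpace E] [BorelSpace E]

/-- A smooth probability density on `E` vanishing outside the ball of radius `ε`, used to smooth
functions by convolution. -/
structure IsMollifier (η : E → ℝ) (ε : ℝ) : Prop where
  contDiff : ContDiff ℝ ∞ η
  nonneg : ∀ x, 0 ≤ η x
  integral_eq_one : ∫ x, η x = 1
  eq_zero : ∀ x, ε < ‖x‖ → η x = 0

theorem exists_isMollifier_isRadial {ε : ℝ} (hε : 0 < ε) :
    ∃ η : E → ℝ, IsMollifier η ε ∧ IsRadial η := by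
  have hr : 0 < 2 / ε := by positivity
  let χ : E → ℝ := cutoff (2 / ε)
  have hpos : 0 < ∫ x, χ x :=
    (contDiff_cutoff _).continuous.integral_pos_of_hasCompactSupport_nonneg_nonzero
      (hasCompactSupport_cutoff hr) (cutoff_nonneg _) (x := 0)
      (by simp [χ, cutoff_eq_one])
  refine ⟨fun x => (∫ x, χ x)⁻¹ * χ x, ⟨contDiff_const.mul (contDiff_cutoff _),
    fun x => mul_nonneg (by positivity) (cutoff_nonneg _ x), ?_, fun x hx => ?_⟩,
    fun x y h => by simp only [χ, isRadial_cutoff _ x y h]⟩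
  · rw [integral_const_mul, inv_mul_cancel₀ hpos.ne']
  · simp only [χ]
    rw [cutoff_eq_zero_of_lt_norm hr (by rwa [div_div_cancel₀ two_ne_zero]), mul_zero]

namespace IsMollifier

variable {η : E → ℝ} {ε : ℝ}

theorem hasCompactSupport (h : IsMollifier η ε) : HasCompactSupport η :=
  hasCompactSupport_of_lt_norm h.eq_zero

theorem integrable (h : IsMollifier η ε) : Integrable η :=
  h.contDiff.continuous.integrable_of_hasCompactSupport h.hasCompactSupport

theorem lintegral_enorm_eq_one (h : IsMollifier η ε) : ∫⁻ x, ‖η x‖ₑ = 1 := by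
  simp only [Real.enorm_eq_ofReal (h.nonneg _)]
  rw [← ofReal_integral_eq_lintegral_ofReal h.integrable (ae_of_all _ h.nonneg),
    h.integral_eq_one, ENNReal.ofReal_one]

variable {F : Type*} [NormedAddCommGroup F] [NormedSpace ℝ F] {f : E → F}

theorem contDiff_convolution (h : IsMollifier η ε) (hf : LocallyIntegrable f) :
    ContDiff ℝ ∞ (η ⋆ f) :=
  h.hasCompactSupport.contDiff_convolution_left _ h.contDiff hf

theorem enorm_convolution_sub_sq_le [CompleteSpace F] (h : IsMollifier η ε)
    (hf : LocallyIntegrable f) (x : E) :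
    ‖(η ⋆ f) x - f x‖ₑ ^ 2 ≤ ∫⁻ t, ‖η t‖ₑ * ‖f (x - t) - f x‖ₑ ^ 2 := by
  have hint : Integrable (fun t => η t • f (x - t)) :=
    h.hasCompactSupport.convolutionExists_left (ContinuousLinearMap.lsmul ℝ ℝ)
      h.contDiff.continuous hf x
  have hdiff : (η ⋆ f) x - f x = ∫ t, η t • (f (x - t) - f x) := by
    simp only [smul_sub]
    rw [integral_sub hint (h.integrable.smul_const _), integral_smul_const, h.integral_eq_one,
      one_smul, convolution_lsmul]
  have hmeas : AEMeasurable fun t => ‖f (x - t) - f x‖ₑ :=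
    ((hf.aestronglyMeasurable.comp_quasiMeasurePreserving
      (quasiMeasurePreserving_sub_left_of_right_invariant volume x)).sub
        aestronglyMeasurable_const).enorm
  calc ‖(η ⋆ f) x - f x‖ₑ ^ 2
      ≤ (∫⁻ t, ‖η t‖ₑ * ‖f (x - t) - f x‖ₑ) ^ 2 := by
        simp only [hdiff, ← enorm_smul]
        gcongr
        exact enorm_integral_le_lintegral_enorm _
    _ ≤ (∫⁻ t, ‖η t‖ₑ) * ∫⁻ t, ‖η t‖ₑ * ‖f (x - t) - f x‖ₑ ^ 2 :=
        sq_lintegral_mul_le_lintegral_mul_sq h.integrable.1.enorm hmeas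
    _ = _ := by rw [h.lintegral_enorm_eq_one, one_mul]

theorem eLpNorm_convolution_sub_le [CompleteSpace F] (h : IsMollifier η ε) (hf : MemLp f 2)
    {δ : ℝ≥0∞} (hδ : ∀ t, ‖t‖ ≤ ε → eLpNorm (fun x => f (x - t) - f x) 2 ≤ δ) :
    eLpNorm (η ⋆ f - f) 2 ≤ δ := by
  have hmeas : AEMeasurable (fun z : E × E => ‖η z.2‖ₑ * ‖f (z.1 - z.2) - f z.1‖ₑ ^ 2)
      (volume.prod volume) :=
    h.integrable.1.comp_snd.enorm.mul (((hf.1.comp_quasiMeasurePreserving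
      (quasiMeasurePreserving_sub_of_right_invariant volume volume)).sub
        hf.1.comp_fst).enorm.pow_const 2)
  have hshift (t : E) : ‖η t‖ₑ * ∫⁻ x, ‖f (x - t) - f x‖ₑ ^ 2 ≤ ‖η t‖ₑ * δ ^ 2 := by
    rcases le_or_gt ‖t‖ ε with ht | ht
    · rw [lintegral_enorm_pow_eq two_ne_zero, Nat.cast_ofNat]
      gcongr
      exact hδ t ht
    · simp [h.eq_zero t ht]
  have hsq : eLpNorm (η ⋆ f - f) 2 ^ 2 = ∫⁻ x, ‖(η ⋆ f) x - f x‖ₑ ^ 2 := by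
    rw [← Nat.cast_ofNat, ← lintegral_enorm_pow_eq two_ne_zero]
    rfl
  refine (ENNReal.pow_le_pow_left_iff two_ne_zero).1 (hsq.trans_le ?_)
  calc ∫⁻ x, ‖(η ⋆ f) x - f x‖ₑ ^ 2
      ≤ ∫⁻ x, ∫⁻ t, ‖η t‖ₑ * ‖f (x - t) - f x‖ₑ ^ 2 :=
        lintegral_mono (h.enorm_convolution_sub_sq_le (hf.locallyIntegrable one_le_two))
    _ = ∫⁻ t, ‖η t‖ₑ * ∫⁻ x, ‖f (x - t) - f x‖ₑ ^ 2 := by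
        simp only [← lintegral_const_mul' _ _ enorm_ne_top]
        exact lintegral_lintegral_swap hmeas
    _ ≤ ∫⁻ t, ‖η t‖ₑ * δ ^ 2 := lintegral_mono hshift
    _ = δ ^ 2 := by
        rw [lintegral_mul_const'' _ h.integrable.1.enorm, h.lintegral_enorm_eq_one, one_mul]

theorem memLp_convolution [CompleteSpace F] (h : IsMollifier η ε) (hf : MemLp f 2) :
    MemLp (η ⋆ f) 2 := by
  have hdist : eLpNorm (η ⋆ f - f) 2 ≤ eLpNorm f 2 + eLpNorm f 2 := by
    refine h.eLpNorm_convolution_sub_le hf fun t _ => ?_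
    have hshift := measurePreserving_sub_right volume t
    exact (eLpNorm_sub_le (hf.1.comp_measurePreserving hshift) hf.1 one_le_two).trans_eq
      (by rw [← eLpNorm_comp_measurePreserving hf.1 hshift, Function.comp_def])
  have hmeas : AEStronglyMeasurable (η ⋆ f) :=
    (h.contDiff_convolution (hf.locallyIntegrable one_le_two)).continuous.aestronglyMeasurable
  have hsub : MemLp (η ⋆ f - f) 2 :=
    ⟨hmeas.sub hf.1, hdist.trans_lt (ENNReal.add_lt_top.2 ⟨hf.2, hf.2⟩)⟩
  simpa using hsub.add hf

end IsMollifier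

variable {F : Type*} [NormedAddCommGroup F] [NormedSpace ℝ F]

theorem tendsto_eLpNorm_translate_sub {V : Type*} [NormedAddCommGroup V] {p : ℝ≥0∞}
    (hp : 1 ≤ p) (hp' : p ≠ ⊤) {f : E → V}
    (hf : MemLp f p) :
    Tendsto (fun t => eLpNorm (fun x => f (x - t) - f x) p) (𝓝 0) (𝓝 0) := by
  have : Fact (1 ≤ p) := ⟨hp⟩
  have : Fact (p ≠ ⊤) := ⟨hp'⟩
  have hcont : Continuous fun t : E => DomAddAct.mk (-t) +ᵥ hf.toLp f := by
    have : Continuous fun t : E => DomAddAct.mk (-t) :=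
      DomAddAct.continuous_mk.comp continuous_neg
    fun_prop
  refine (tendsto_iff_edist_tendsto_0.1 (hcont.tendsto 0)).congr fun t => ?_
  rw [neg_zero, DomAddAct.mk_vadd_toLp, DomAddAct.mk_vadd_toLp, Lp.edist_toLp_toLp]
  exact eLpNorm_congr_ae (ae_of_all _ fun x => by simp [sub_eq_neg_add])

theorem tendsto_eLpNorm_convolution_sub [CompleteSpace F] {ι : Type*} {l : Filter ι}
    {η : ι → E → ℝ} {ε : ι → ℝ} (hη : ∀ i, IsMollifier (η i) (ε i)) (hε : Tendsto ε l (𝓝 0))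
    {f : E → F} (hf : MemLp f 2) :
    Tendsto (fun i => eLpNorm (η i ⋆ f - f) 2) l (𝓝 0) := by
  refine ENNReal.tendsto_nhds_zero.2 fun δ hδ => ?_
  obtain ⟨r, hr, hclose⟩ := Metric.eventually_nhds_iff.1 (ENNReal.tendsto_nhds_zero.1
    (tendsto_eLpNorm_translate_sub one_le_two ENNReal.ofNat_ne_top hf) δ hδ)
  filter_upwards [hε.eventually_lt_const hr] with i hi
  exact (hη i).eLpNorm_convolution_sub_le hf fun t ht => hclose (by simpa using ht.trans_lt hi)

/-- Two points of equal norm are exchanged by a reflection, which preserves Lebesgue measure. -/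
theorem IsRadial.convolution {η : E → ℝ} (hη : IsRadial η) {u : E → F} {f : ℝ → F}
    (hu : ∀ᵐ x, u x = f ‖x‖) : IsRadial (η ⋆ u) := by
  intro x y hxy
  let L : E ≃ₗᵢ[ℝ] E := (ℝ ∙ (x - y))ᗮ.reflection
  have hLx : L x = y := Submodule.reflection_sub hxy
  have hux : ∀ᵐ t, u (x - t) = f ‖x - t‖ :=
    (quasiMeasurePreserving_sub_left_of_right_invariant volume x).ae hu
  have huy : ∀ᵐ t, u (y - L t) = f ‖y - L t‖ :=
    L.measurePreserving.quasiMeasurePreserving.ae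
      ((quasiMeasurePreserving_sub_left_of_right_invariant volume y).ae hu)
  rw [convolution_lsmul, convolution_lsmul (x := y),
    ← L.measurePreserving.integral_comp L.toHomeomorph.measurableEmbedding
      fun t => η t • u (y - t)]
  refine integral_congr_ae ?_
  filter_upwards [hux, huy] with t hux huy
  rw [hux, huy, hη (L t) t (L.norm_map t), ← hLx, ← map_sub, L.norm_map]

theorem tendsto_eLpNorm_cutoff_smul_sub_self {ι : Type*} {l : Filter ι} [l.IsCountablyGenerated]
    {r : ι → ℝ} (hr : Tendsto r l (𝓝 0)) {f : E → F} (hf : MemLp f 2) :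
    Tendsto (fun i => eLpNorm (fun x => cutoff (r i) x • f x - f x) 2) l (𝓝 0) := by
  have hsq : Tendsto (fun i => ∫⁻ x, ‖cutoff (r i) x • f x - f x‖ₑ ^ 2) l
      (𝓝 (∫⁻ _ : E, 0)) := by
    refine tendsto_lintegral_filter_of_dominated_convergence' (fun x => ‖f x‖ₑ ^ 2)
      (Eventually.of_forall fun i => ?_) (Eventually.of_forall fun i => ae_of_all _ fun x => ?_)
      ?_ (ae_of_all _ fun x => ?_)
    · exact (((contDiff_cutoff (r i)).continuous.aestronglyMeasurable.smul hf.1).sub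
        hf.1).enorm.pow_const 2
    · have habs : ‖cutoff (r i) x - 1‖ₑ ≤ 1 := by
        rw [enorm_sub_rev, Real.enorm_eq_ofReal (sub_nonneg.2 (cutoff_le_one _ x)),
          ENNReal.ofReal_le_one]
        exact sub_le_self _ (cutoff_nonneg _ x)
      gcongr
      calc ‖cutoff (r i) x • f x - f x‖ₑ = ‖cutoff (r i) x - 1‖ₑ * ‖f x‖ₑ := by
            rw [← enorm_smul, sub_smul, one_smul]
        _ ≤ ‖f x‖ₑ := mul_le_of_le_one_left' habs
    · rw [lintegral_enorm_pow_eq two_ne_zero]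
      simp [hf.eLpNorm_ne_top]
    · have hsmall : Tendsto (fun i => ‖r i • x‖) l (𝓝 0) := by
        simpa using (hr.smul_const x).norm
      refine tendsto_const_nhds.congr' ?_
      filter_upwards [hsmall.eventually_lt_const one_pos] with i hi
      simp [cutoff_eq_one hi.le]
  simp only [lintegral_zero, lintegral_enorm_pow_eq two_ne_zero, Nat.cast_ofNat] at hsq
  simpa only [← ENNReal.rpow_two, ← ENNReal.rpow_mul, mul_inv_cancel₀ (two_ne_zero' ℝ),
    ENNReal.rpow_one, ENNReal.zero_rpow_of_pos (inv_pos.2 (two_pos (α := ℝ)))]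
    using hsq.ennrpow_const (2⁻¹ : ℝ)

theorem tendsto_eLpNorm_cutoff_smul_sub {ι : Type*} {l : Filter ι} [l.IsCountablyGenerated]
    {r : ι → ℝ} (hr : Tendsto r l (𝓝 0)) {f : ι → E → F} {g : E → F}
    (hf : ∀ i, AEStronglyMeasurable (f i)) (hg : MemLp g 2)
    (h : Tendsto (fun i => eLpNorm (f i - g) 2) l (𝓝 0)) :
    Tendsto (fun i => eLpNorm ((cutoff (r i) : E → ℝ) • f i - g) 2) l (𝓝 0) := by
  have hχ (i : ι) : AEStronglyMeasurable (cutoff (r i) : E → ℝ) :=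
    (contDiff_cutoff (r i)).continuous.aestronglyMeasurable
  have hself : Tendsto (fun i => eLpNorm ((cutoff (r i) : E → ℝ) • g - g) 2) l (𝓝 0) :=
    tendsto_eLpNorm_cutoff_smul_sub_self hr hg
  have hsum := h.add hself
  rw [add_zero] at hsum
  refine tendsto_of_tendsto_of_tendsto_of_le_of_le tendsto_const_nhds hsum
    (fun _ => zero_le) fun i => ?_
  have hf' : AEStronglyMeasurable ((cutoff (r i) : E → ℝ) • (f i - g)) :=
    (hχ i).smul ((hf i).sub hg.1)
  have hg' : AEStronglyMeasurable ((cutoff (r i) : E → ℝ) • g - g) := ((hχ i).smul hg.1).sub hg.1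
  have hsplit : (cutoff (r i) : E → ℝ) • f i - g
      = (cutoff (r i) : E → ℝ) • (f i - g) + ((cutoff (r i) : E → ℝ) • g - g) := by
    ext1 x
    simp [smul_sub]
  rw [hsplit]
  refine (eLpNorm_add_le hf' hg' one_le_two).trans ?_
  gcongr
  refine eLpNorm_mono_enorm fun x => ?_
  rw [Pi.smul_apply', enorm_smul]
  exact mul_le_of_le_one_left' (enorm_cutoff_le_one _ x)

theorem tendsto_eLpNorm_smul_gradient_cutoff {ι : Type*} {l : Filter ι} {r : ι → ℝ}
    (hr : Tendsto r l (𝓝 0)) {f : ι → E → ℝ} {g : E → ℝ} (hf : ∀ i, MemLp (f i) 2)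
    (hg : MemLp g 2) (h : Tendsto (fun i => eLpNorm (f i - g) 2) l (𝓝 0)) :
    Tendsto (fun i => eLpNorm (f i • gradient (cutoff (r i) : E → ℝ)) 2) l (𝓝 0) := by
  obtain ⟨C, hC⟩ := exists_norm_fderiv_cutoff_le (E := E)
  have hsmall : Tendsto (fun i => ENNReal.ofReal (C * |r i|)) l (𝓝 0) := by
    simpa using ENNReal.tendsto_ofReal (hr.abs.const_mul C)
  have hprod := ENNReal.Tendsto.mul hsmall (Or.inr hg.eLpNorm_ne_top)
    (tendsto_eLpNorm_of_tendsto_sub one_le_two hf hg h) (Or.inr ENNReal.zero_ne_top)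
  rw [zero_mul] at hprod
  refine tendsto_of_tendsto_of_tendsto_of_le_of_le tendsto_const_nhds hprod
    (fun _ => zero_le) fun i =>
      eLpNorm_le_mul_eLpNorm_of_ae_le_mul (ae_of_all _ fun x => ?_) 2
  rw [Pi.smul_apply', norm_smul, norm_gradient, mul_comm]
  gcongr
  exact hC _ x

end Mollification

section TestFunctions

/-- A smooth compactly supported function on `ℝ³`. -/
structure IsTestFunction (v : R3 → ℝ) : Prop where
  contDiff : ContDiff ℝ ∞ v
  hasCompactSupport : HasCompactSupport v

theorem gradient_apply (v : R3 → ℝ) (x : R3) (i : Fin 3) :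
    gradient v x i = fderiv ℝ v x (EuclideanSpace.single i 1) := by
  have h : gradient v x i = inner ℝ (gradient v x) (EuclideanSpace.single i 1) := by
    rw [EuclideanSpace.inner_single_right]
    simp
  rw [h, gradient, InnerProductSpace.toDual_symm_apply]

namespace IsTestFunction

variable {v : R3 → ℝ}

theorem contDiff_one (hv : IsTestFunction v) : ContDiff ℝ 1 v := hv.contDiff.of_le (by simp)

theorem memLp (hv : IsTestFunction v) (q : ℝ≥0∞) : MemLp v q :=
  hv.contDiff.continuous.memLp_of_hasCompactSupport hv.hasCompactSupport

theorem memLp_gradient (hv : IsTestFunction v) (q : ℝ≥0∞) : MemLp (gradient v) q :=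
  (continuous_gradient hv.contDiff_one).memLp_of_hasCompactSupport
    (hv.hasCompactSupport.fderiv (𝕜 := ℝ) |>.comp_left (map_zero _))

theorem hasL2WeakGradient (hv : IsTestFunction v) : HasL2WeakGradient v (gradient v) := by
  refine ⟨hv.memLp_gradient 2, fun φ hφ hφc i => ?_⟩
  have hv_cont := hv.contDiff.continuous
  have hφ_cont := hφ.continuous
  have hdv : Continuous fun x => fderiv ℝ v x (EuclideanSpace.single i 1) :=
    (hv.contDiff.continuous_fderiv (by simp)).clm_apply continuous_const
  have hdφ : Continuous fun x => fderiv ℝ φ x (EuclideanSpace.single i 1) :=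
    (hφ.continuous_fderiv (by simp)).clm_apply continuous_const
  simp only [gradient_apply]
  exact integral_mul_fderiv_eq_neg_fderiv_mul_of_integrable
    ((hdv.mul hφ_cont).integrable_of_hasCompactSupport hφc.mul_left)
    ((hv_cont.mul hdφ).integrable_of_hasCompactSupport hv.hasCompactSupport.mul_right)
    ((hv_cont.mul hφ_cont).integrable_of_hasCompactSupport hv.hasCompactSupport.mul_right)
    (fun x _ => hv.contDiff.differentiable (by simp) x)
    (fun x _ => hφ.differentiable (by simp) x)

theorem mem_H1 (hv : IsTestFunction v) : v ∈ H1 := ⟨hv.memLp 2, _, hv.hasL2WeakGradient⟩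

end IsTestFunction

theorem fderiv_comp_sub_left {η : R3 → ℝ} (hη : Differentiable ℝ η) (x t : R3) :
    fderiv ℝ (fun t => η (x - t)) t = -fderiv ℝ η (x - t) := by
  have hcomp := (hη (x - t)).hasFDerivAt.comp t ((hasFDerivAt_id t).const_sub x)
  refine hcomp.fderiv.trans ?_
  ext y
  simp

theorem HasL2WeakGradient.gradient_convolution {η : R3 → ℝ} {ε : ℝ} (hη : IsMollifier η ε)
    {u : R3 → ℝ} {G : R3 → R3} (hG : HasL2WeakGradient u G) (hu : LocallyIntegrable u) :
    gradient (η ⋆ u) = η ⋆ G := by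
  ext x i
  have hη1 : ContDiff ℝ 1 η := hη.contDiff.of_le (by simp)
  have hφ : ContDiff ℝ ∞ fun t => η (x - t) := hη.contDiff.comp (contDiff_const.sub contDiff_id)
  have hφc : HasCompactSupport fun t => η (x - t) :=
    hη.hasCompactSupport.comp_homeomorph (Homeomorph.subLeft x)
  have hint : Integrable fun t => η (x - t) • G t :=
    (hG.memLp.locallyIntegrable one_le_two).integrable_smul_left_of_hasCompactSupport
      hφ.continuous hφc
  have hparts := hG.integral_eq _ hφ hφc i
  simp only [fderiv_comp_sub_left (hη1.differentiable one_ne_zero), neg_apply, mul_neg,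
    integral_neg, neg_inj] at hparts
  calc gradient (η ⋆ u) x i
      = ∫ t, u t * fderiv ℝ η (x - t) (EuclideanSpace.single i 1) := by
        rw [gradient_apply, ← convolution_flip,
          (hη.hasCompactSupport.hasFDerivAt_convolution_right _ hu hη1 x).fderiv,
          convolution_precompR_apply _ hu (hη.hasCompactSupport.fderiv (𝕜 := ℝ))
            (hη1.continuous_fderiv one_ne_zero)]
        simp [convolution, mul_comm]
    _ = ∫ t, G t i * η (x - t) := hparts
    _ = ∫ t, EuclideanSpace.proj (𝕜 := ℝ) i (η (x - t) • G t) := by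
        simp [mul_comm]
    _ = (η ⋆ G) x i := by
        rw [(EuclideanSpace.proj (𝕜 := ℝ) i).integral_comp_comm hint, convolution_lsmul_swap]
        rfl

theorem HasL2WeakGradient.tendsto_gradient_cutoff_mul_convolution {r : ℕ → ℝ} {η : ℕ → R3 → ℝ}
    (hη : ∀ n, IsMollifier (η n) (r n)) (hr : Tendsto r atTop (𝓝 0)) {u : R3 → ℝ} {G : R3 → R3}
    (hu : MemLp u 2) (hG : HasL2WeakGradient u G) :
    Tendsto (fun n => eLpNorm (gradient (cutoff (r n) * (η n ⋆ u)) - G) 2) atTop (𝓝 0) := by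
  have hu_loc := hu.locallyIntegrable one_le_two
  have hχ (n : ℕ) : ContDiff ℝ 1 (cutoff (r n) : R3 → ℝ) := (contDiff_cutoff _).of_le (by simp)
  have hmem_u (n : ℕ) : MemLp (η n ⋆ u) 2 := (hη n).memLp_convolution hu
  have hmem_G (n : ℕ) : MemLp (η n ⋆ G) 2 := (hη n).memLp_convolution hG.memLp
  have hgrad (n : ℕ) : gradient (cutoff (r n) * (η n ⋆ u)) - G
      = ((cutoff (r n) : R3 → ℝ) • (η n ⋆ G) - G)
        + (η n ⋆ u) • gradient (cutoff (r n) : R3 → ℝ) := by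
    rw [gradient_mul ((hχ n).differentiable one_ne_zero)
      (((hη n).contDiff_convolution hu_loc).differentiable (by simp)),
      hG.gradient_convolution (hη n) hu_loc, add_sub_right_comm]
  have hfst (n : ℕ) : AEStronglyMeasurable ((cutoff (r n) : R3 → ℝ) • (η n ⋆ G) - G) :=
    ((hχ n).continuous.aestronglyMeasurable.smul (hmem_G n).1).sub hG.memLp.1
  have hsnd (n : ℕ) : AEStronglyMeasurable ((η n ⋆ u) • gradient (cutoff (r n) : R3 → ℝ)) :=
    (hmem_u n).1.smul (continuous_gradient (hχ n)).aestronglyMeasurable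
  have hsum := (tendsto_eLpNorm_cutoff_smul_sub hr (fun n => (hmem_G n).1) hG.memLp
    (tendsto_eLpNorm_convolution_sub hη hr hG.memLp)).add
      (tendsto_eLpNorm_smul_gradient_cutoff hr hmem_u hu
        (tendsto_eLpNorm_convolution_sub hη hr hu))
  rw [add_zero] at hsum
  refine tendsto_of_tendsto_of_tendsto_of_le_of_le tendsto_const_nhds hsum
    (fun _ => zero_le) fun n => ?_
  rw [hgrad]
  exact eLpNorm_add_le (hfst n) (hsnd n) one_le_two

theorem exists_isTestFunction_tendsto {u : R3 → ℝ} {G : R3 → R3} (hu : MemLp u 2)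
    (hG : HasL2WeakGradient u G) :
    ∃ v : ℕ → R3 → ℝ, (∀ n, IsTestFunction (v n)) ∧
      Tendsto (fun n => eLpNorm (v n - u) 2) atTop (𝓝 0) ∧
      Tendsto (fun n => eLpNorm (gradient (v n) - G) 2) atTop (𝓝 0) ∧
      ((∃ f : ℝ → ℝ, ∀ᵐ x, u x = f ‖x‖) → ∀ n, IsRadial (v n)) := by
  let r (n : ℕ) : ℝ := 1 / (n + 1)
  have hr_pos (n : ℕ) : 0 < r n := by positivity
  have hr : Tendsto r atTop (𝓝 0) := tendsto_one_div_add_atTop_nhds_zero_nat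
  choose η hη hη_rad using fun n => exists_isMollifier_isRadial (E := R3) (hr_pos n)
  have hu_loc := hu.locallyIntegrable one_le_two
  have hsmooth (n : ℕ) : ContDiff ℝ ∞ (η n ⋆ u) := (hη n).contDiff_convolution hu_loc
  have hu_lim := tendsto_eLpNorm_convolution_sub hη hr hu
  refine ⟨fun n => cutoff (r n) * (η n ⋆ u), fun n => ⟨(contDiff_cutoff _).mul (hsmooth n),
    (hasCompactSupport_cutoff (hr_pos n)).mul_right⟩, ?_, ?_, ?_⟩
  · exact tendsto_eLpNorm_cutoff_smul_sub hr
      (fun n => (hsmooth n).continuous.aestronglyMeasurable) hu hu_lim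
  · exact hG.tendsto_gradient_cutoff_mul_convolution hη hr hu
  · rintro ⟨f, hf⟩ n x y hxy
    simp only [Pi.mul_apply, isRadial_cutoff _ x y hxy, (hη_rad n).convolution hf x y hxy]

end TestFunctions

section Sobolev

/-- The constant of the Sobolev embedding of `H¹(ℝ³)` in `L⁶(ℝ³)`. -/
def sobolevConst : ℝ≥0 := SNormLESNormFDerivOfEqConst ℝ (volume : Measure R3) 2

theorem IsTestFunction.eLpNorm_six_le {v : R3 → ℝ} (hv : IsTestFunction v) :
    eLpNorm v 6 ≤ sobolevConst * eLpNorm (gradient v) 2 := by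
  have hsobolev := eLpNorm_le_eLpNorm_fderiv_of_eq (volume : Measure R3) hv.contDiff_one
    hv.hasCompactSupport (p := 2) (p' := 6) (by norm_num) (by simp) (by norm_num)
  rw [eLpNorm_congr_norm_ae (ae_of_all _ (norm_gradient v))]
  exact_mod_cast hsobolev

namespace HasL2WeakGradient

variable {u v : R3 → ℝ} {G H : R3 → R3}

theorem sub (hG : HasL2WeakGradient u G) (hH : HasL2WeakGradient v H) (hu : MemLp u 2)
    (hv : MemLp v 2) : HasL2WeakGradient (u - v) (G - H) := by
  refine ⟨hG.memLp.sub hH.memLp, fun φ hφ hφc i => ?_⟩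
  have hφ_cont : Continuous φ := hφ.continuous
  have hdφ : Continuous fun x => fderiv ℝ φ x (EuclideanSpace.single i 1) :=
    (hφ.continuous_fderiv (by simp)).clm_apply continuous_const
  have hdφc : HasCompactSupport fun x => fderiv ℝ φ x (EuclideanSpace.single i 1) :=
    (hφc.fderiv (𝕜 := ℝ)).comp_left (g := fun L : R3 →L[ℝ] ℝ => L _) rfl
  have hint_left {w : R3 → ℝ} (hw : MemLp w 2) :
      Integrable fun x => w x * fderiv ℝ φ x (EuclideanSpace.single i 1) :=
    (hw.locallyIntegrable one_le_two).integrable_smul_right_of_hasCompactSupport hdφ hdφc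
  have hint_right {F : R3 → R3} (hF : MemLp F 2) : Integrable fun x => F x i * φ x := by
    have hFi : MemLp (fun x => F x i) 2 := (EuclideanSpace.proj (𝕜 := ℝ) i).comp_memLp' hF
    exact (hFi.locallyIntegrable one_le_two).integrable_smul_right_of_hasCompactSupport
      hφ_cont hφc
  simp only [Pi.sub_apply, PiLp.sub_apply, sub_mul]
  rw [integral_sub (hint_left hu) (hint_left hv), hG.integral_eq φ hφ hφc i,
    hH.integral_eq φ hφ hφc i, integral_sub (hint_right hG.memLp) (hint_right hH.memLp)]
  ring

theorem eLpNorm_six_le (hG : HasL2WeakGradient u G) (hu : MemLp u 2) :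
    eLpNorm u 6 ≤ sobolevConst * eLpNorm G 2 := by
  obtain ⟨v, hv, hv_lim, hgrad_lim, -⟩ := exists_isTestFunction_tendsto hu hG
  obtain ⟨φ, hφ, hae⟩ := (tendstoInMeasure_of_tendsto_eLpNorm two_ne_zero
    (fun n => ((hv n).memLp 2).1) hu.1 hv_lim).exists_seq_tendsto_ae
  have hbound : Tendsto (fun n => sobolevConst * eLpNorm (gradient (v (φ n))) 2) atTop
      (𝓝 (sobolevConst * eLpNorm G 2)) :=
    (ENNReal.Tendsto.const_mul (tendsto_eLpNorm_of_tendsto_sub one_le_two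
      (fun n => (hv n).memLp_gradient 2) hG.memLp hgrad_lim)
        (Or.inr ENNReal.coe_ne_top)).comp hφ.tendsto_atTop
  have hfatou : eLpNorm u 6 ≤ liminf (fun n => eLpNorm (v (φ n)) 6) atTop :=
    Lp.eLpNorm_lim_le_liminf_eLpNorm (fun n => ((hv _).memLp 6).1) u hae
  refine hfatou.trans ?_
  rw [← hbound.liminf_eq]
  exact liminf_le_liminf (Eventually.of_forall fun n => (hv _).eLpNorm_six_le)

theorem tendsto_eLpNorm_sub {v : ℕ → R3 → ℝ} {H : ℕ → R3 → R3} {q : ℝ≥0} (hq2 : 2 ≤ q)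
    (hq6 : q ≤ 6) (hH : ∀ n, HasL2WeakGradient (v n) (H n)) (hG : HasL2WeakGradient u G)
    (hv : ∀ n, MemLp (v n) 2) (hu : MemLp u 2)
    (h : Tendsto (fun n => eLpNorm (v n - u) 2) atTop (𝓝 0))
    (h' : Tendsto (fun n => eLpNorm (H n - G) 2) atTop (𝓝 0)) :
    Tendsto (fun n => eLpNorm (v n - u) q) atTop (𝓝 0) := by
  have hlim : Tendsto (fun n => sobolevConst * eLpNorm (H n - G) 2) atTop (𝓝 0) := by
    simpa using ENNReal.Tendsto.const_mul h' (Or.inr ENNReal.coe_ne_top)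
  have hsix : Tendsto (fun n => eLpNorm (v n - u) 6) atTop (𝓝 0) :=
    tendsto_of_tendsto_of_tendsto_of_le_of_le tendsto_const_nhds hlim (fun _ => zero_le)
      fun n => ((hH n).sub hG (hv n) hu).eLpNorm_six_le ((hv n).sub hu)
  exact tendsto_eLpNorm_of_tendsto_of_tendsto two_ne_zero hq2 hq6
    (fun n => ((hv n).sub hu).1) h hsix

end HasL2WeakGradient

theorem memLp_of_mem_H1 {u : R3 → ℝ} (hu : u ∈ H1) {q : ℝ≥0} (hq2 : 2 ≤ q) (hq6 : q ≤ 6) :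
    MemLp u q := by
  obtain ⟨hu2, G, hG⟩ := hu
  refine memLp_of_memLp_of_memLp two_ne_zero hq2 hq6 hu2 ⟨hu2.1, ?_⟩
  exact (hG.eLpNorm_six_le hu2).trans_lt
    (ENNReal.mul_lt_top ENNReal.coe_lt_top hG.memLp.eLpNorm_lt_top)

theorem memLp_four_of_mem_H1 {u : R3 → ℝ} (hu : u ∈ H1) : MemLp u 4 :=
  memLp_of_mem_H1 hu (q := 4) (by norm_num) (by norm_num)

theorem integrable_abs_rpow_of_mem_H1 {u : R3 → ℝ} (hu : u ∈ H1) {p : ℝ} (hp2 : 2 ≤ p)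
    (hp6 : p ≤ 6) : Integrable fun x => |u x| ^ p := by
  lift p to ℝ≥0 using by linarith
  have hp2' : 2 ≤ p := by exact_mod_cast hp2
  exact integrable_norm_rpow (zero_lt_two.trans_le hp2').ne'
    (memLp_of_mem_H1 hu hp2' (by exact_mod_cast hp6))

theorem energy_eq {u : R3 → ℝ} (hu : u ∈ H1) {G : R3 → R3} (hG : HasL2WeakGradient u G)
    (p lam : ℝ) :
    energy p lam u = (1 / 2) * ((∫ x, ‖G x‖ ^ 2) + ∫ x, u x ^ 2)
      + (lam / 4) * (coulombEnergy u).toReal - (1 / p) * ∫ x, |u x| ^ p := by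
  have hG_int : Integrable fun x => ‖G x‖ ^ 2 := hG.memLp.integrable_norm_pow two_ne_zero
  have hgrad : ∫ x, (‖weakGradient u x‖ ^ 2 + u x ^ 2) = (∫ x, ‖G x‖ ^ 2) + ∫ x, u x ^ 2 := by
    rw [← integral_add hG_int hu.1.integrable_sq]
    refine integral_congr_ae ?_
    filter_upwards [(hasL2WeakGradient_weakGradient hu).ae_eq hG] with x hx
    rw [hx]
  rw [energy, hgrad, integral_coulombIntegrand hu.1 (memLp_four_of_mem_H1 hu)]

theorem exists_isTestFunction_tendsto_energy {u : R3 → ℝ} (hu : u ∈ H1) {p : ℝ} (hp2 : 2 ≤ p)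
    (hp6 : p ≤ 6) :
    ∃ v : ℕ → R3 → ℝ, (∀ n, IsTestFunction (v n)) ∧
      (∀ lam, Tendsto (fun n => energy p lam (v n)) atTop (𝓝 (energy p lam u))) ∧
      ((∃ f : ℝ → ℝ, ∀ᵐ x, u x = f ‖x‖) → ∀ n, IsRadial (v n)) := by
  obtain ⟨G, hG⟩ := hu.2
  obtain ⟨v, hv, hv_lim, hgrad_lim, hrad⟩ := exists_isTestFunction_tendsto hu.1 hG
  refine ⟨v, hv, fun lam => ?_, hrad⟩
  lift p to ℝ≥0 using by linarith
  have hv2 (n : ℕ) : MemLp (v n) 2 := (hv n).memLp 2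
  have hLq {q : ℝ≥0} (hq2 : 2 ≤ q) (hq6 : q ≤ 6) :
      Tendsto (fun n => eLpNorm (v n - u) q) atTop (𝓝 0) :=
    HasL2WeakGradient.tendsto_eLpNorm_sub hq2 hq6 (fun n => (hv n).hasL2WeakGradient) hG hv2
      hu.1 hv_lim hgrad_lim
  have hkin := tendsto_integral_norm_rpow (q := 2) one_le_two (fun n => (hv n).memLp_gradient 2)
    hG.memLp hgrad_lim
  have hmass := tendsto_integral_norm_rpow (q := 2) one_le_two hv2 hu.1 hv_lim
  have hcoulomb := tendsto_toReal_coulombEnergy hv2 (fun n => (hv n).memLp 4) hu.1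
    (memLp_four_of_mem_H1 hu) hv_lim (hLq (q := 4) (by norm_num) (by norm_num))
  have hp2' : 2 ≤ p := by exact_mod_cast hp2
  have hp6' : p ≤ 6 := by exact_mod_cast hp6
  have hpow := tendsto_integral_norm_rpow (one_le_two.trans hp2') (fun n => (hv n).memLp p)
    (memLp_of_mem_H1 hu hp2' hp6') (hLq hp2' hp6')
  simp only [NNReal.coe_ofNat, Real.rpow_two, Real.norm_eq_abs, sq_abs] at hkin hmass hpow
  rw [energy_eq hu hG]
  simp only [fun n => energy_eq (hv n).mem_H1 (hv n).hasL2WeakGradient p lam]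
  exact (((hkin.add hmass).const_mul _).add (hcoulomb.const_mul _)).sub (hpow.const_mul _)

end Sobolev

section RadialLemma

variable {E F : Type*} [NormedAddCommGroup E] [InnerProductSpace ℝ E] [MeasurableSpace E]
  [BorelSpace E] [FiniteDimensional ℝ E] [Nontrivial E] (μ : Measure E) [μ.IsAddHaarMeasure]
  [NormedAddCommGroup F] [NormedSpace ℝ F] [CompleteSpace F]

open Module

theorem IsRadial.toSphere_mul_enorm_le_lintegral_fderiv {u : E → F} (hr : IsRadial u)
    (hu : ContDiff ℝ 1 u) (hc : HasCompactSupport u) (x : E) :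
    μ.toSphere univ * (ENNReal.ofReal (‖x‖ ^ (finrank ℝ E - 1)) * ‖u x‖ₑ)
      ≤ ∫⁻ y, ‖fderiv ℝ u y‖ₑ ∂μ := by
  have : Continuous (fderiv ℝ u) := hu.continuous_fderiv one_ne_zero
  have along_ray (θ : Metric.sphere (0 : E) 1) :
      ENNReal.ofReal (‖x‖ ^ (finrank ℝ E - 1)) * ‖u x‖ₑ ≤ ∫⁻ r in Ioi (0 : ℝ),
        ENNReal.ofReal (r ^ (finrank ℝ E - 1)) * ‖fderiv ℝ u (r • (θ : E))‖ₑ := by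
    let g (r : ℝ) : ℝ≥0∞ :=
      ENNReal.ofReal (r ^ (finrank ℝ E - 1)) * ‖fderiv ℝ u (r • (θ : E))‖ₑ
    have hshift : ∫⁻ r in Ioi (0 : ℝ), g (‖x‖ + r) = ∫⁻ r in Ioi ‖x‖, g r := by
      simpa using (measurePreserving_add_left volume ‖x‖).setLIntegral_comp_preimage
        (measurableSet_Ioi (a := ‖x‖)) (f := g) (by fun_prop)
    rw [hr x (‖x‖ • (θ : E)) (by simp [norm_smul])]
    calc ENNReal.ofReal (‖x‖ ^ (finrank ℝ E - 1)) * ‖u (‖x‖ • (θ : E))‖ₑ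
        ≤ ENNReal.ofReal (‖x‖ ^ (finrank ℝ E - 1)) *
            ∫⁻ r in Ioi (0 : ℝ), ‖fderiv ℝ u (‖x‖ • (θ : E) + r • (θ : E))‖ₑ := by
          gcongr
          exact enorm_le_lintegral_ray hu hc _ (by simp)
      _ ≤ ∫⁻ r in Ioi (0 : ℝ), g (‖x‖ + r) := by
          rw [← lintegral_const_mul' _ _ ENNReal.ofReal_ne_top]
          refine setLIntegral_mono (by fun_prop) fun r hr => ?_
          simp only [g, add_smul]
          gcongr
          exact le_add_of_nonneg_right (mem_Ioi.1 hr).le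
      _ ≤ ∫⁻ r in Ioi (0 : ℝ), g r := by
          rw [hshift]
          exact lintegral_mono_set (Ioi_subset_Ioi (norm_nonneg x))
  rw [lintegral_polar μ (by fun_prop), mul_comm, ← lintegral_const]
  exact lintegral_mono along_ray

end RadialLemma

section RadialBound

open scoped Real

/-- The squared `H¹` norm of a test function. -/
def sobolevSq (v : R3 → ℝ) : ℝ :=
  (∫ x, ‖gradient v x‖ ^ 2) + ∫ x, v x ^ 2

theorem sobolevSq_nonneg (v : R3 → ℝ) : 0 ≤ sobolevSq v := by
  unfold sobolevSq; positivity

theorem sq_setLIntegral_le {f : R3 → ℝ≥0∞} (hf : AEMeasurable f) {s : Set R3}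
    (hs : MeasurableSet s) {d : ℝ≥0∞} (hd : ∀ x ∈ s, ∀ y ∈ s, ‖x - y‖ₑ ≤ d) :
    (∫⁻ x in s, f x) ^ 2 ≤ d * coulombPairing f f := by
  have hmeas : AEMeasurable (fun z : R3 × R3 => f z.1 * f z.2 * ‖z.1 - z.2‖ₑ⁻¹)
      (volume.prod volume) := (hf.comp_fst.mul hf.comp_snd).mul (by fun_prop)
  have kernel_ge {x y : R3} (hx : x ∈ s) (hy : y ∈ s) (hyx : y ≠ x) :
      f x * f y ≤ d * (f x * f y * ‖x - y‖ₑ⁻¹) := by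
    have hpos : ‖x - y‖ₑ ≠ 0 := by simpa [sub_eq_zero] using hyx.symm
    calc f x * f y = ‖x - y‖ₑ * (f x * f y * ‖x - y‖ₑ⁻¹) := by
          rw [mul_left_comm, ENNReal.mul_inv_cancel hpos enorm_ne_top, mul_one]
      _ ≤ d * (f x * f y * ‖x - y‖ₑ⁻¹) := by gcongr; exact hd x hx y hy
  calc (∫⁻ x in s, f x) ^ 2 = ∫⁻ x in s, ∫⁻ y in s, f x * f y := by
        rw [sq, ← lintegral_mul_const'' _ hf.restrict]
        exact lintegral_congr fun x => (lintegral_const_mul'' _ hf.restrict).symm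
    _ ≤ ∫⁻ x in s, ∫⁻ y in s, d * (f x * f y * ‖x - y‖ₑ⁻¹) := by
        refine setLIntegral_mono' hs fun x hx => lintegral_mono_ae ?_
        filter_upwards [ae_restrict_mem hs, ae_restrict_of_ae (Measure.ae_ne volume x)]
          with y hy hyx using kernel_ge hx hy hyx
    _ ≤ ∫⁻ x, ∫⁻ y, d * (f x * f y * ‖x - y‖ₑ⁻¹) :=
        (setLIntegral_le_lintegral _ _).trans
          (lintegral_mono fun x => setLIntegral_le_lintegral _ _)
    _ = d * coulombPairing f f := by
        have hmeas_right (x : R3) : AEMeasurable fun y => f x * f y * ‖x - y‖ₑ⁻¹ :=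
          (hf.const_mul _).mul (by fun_prop)
        simp only [lintegral_const_mul'' _ (hmeas_right _)]
        rw [lintegral_const_mul'' _ hmeas.lintegral_prod_right', coulombPairing]

theorem rpow_le_sq_add_cube {p t : ℝ} (hp : p ∈ Ioo (2 : ℝ) 3) (ht : 0 ≤ t) :
    t ^ p ≤ t ^ 2 + t ^ 3 := by
  have key := rpow_le_rpow_add_rpow (ENNReal.ofReal t) hp.1.le hp.2.le
  have hp0 : 0 ≤ p := by linarith [hp.1]
  rw [ENNReal.ofReal_rpow_of_nonneg ht hp0, ENNReal.ofReal_rpow_of_nonneg ht (by norm_num),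
    ENNReal.ofReal_rpow_of_nonneg ht (by norm_num), ← ENNReal.ofReal_add (by positivity)
      (by positivity), ENNReal.ofReal_le_ofReal_iff (by positivity)] at key
  exact_mod_cast key

theorem exists_rpow_le_mul_sq {p : ℝ} (hp : 2 < p) :
    ∃ α : ℝ, 0 < α ∧ ∀ t : ℝ, 0 ≤ t → t ≤ α → t ^ p ≤ (1 / 2) * t ^ 2 := by
  refine ⟨(1 / 2) ^ (p - 2)⁻¹, by positivity, fun t ht htα => ?_⟩
  have hsmall : t ^ (p - 2) ≤ 1 / 2 :=
    (Real.rpow_le_rpow ht htα (by linarith)).trans_eq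
      (Real.rpow_inv_rpow (by norm_num) (by linarith))
  calc t ^ p = t ^ (p - 2) * t ^ 2 := by
        rw [← Real.rpow_two, ← Real.rpow_add' ht (by linarith), sub_add_cancel]
    _ ≤ (1 / 2) * t ^ 2 := by gcongr

theorem exists_rpow_le_mul_sq_add {p : ℝ} (hp : p ∈ Ioo (2 : ℝ) 3) {c : ℝ} (hc : 0 < c) :
    ∃ M : ℝ, ∀ t : ℝ, 0 ≤ t → t ^ p ≤ M * t ^ 2 + c * t ^ 3 := by
  obtain ⟨hp2, hp3⟩ := hp
  set β : ℝ := c⁻¹ ^ (3 - p)⁻¹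
  refine ⟨β ^ (p - 2), fun t ht => ?_⟩
  rcases le_total t β with htβ | hβt
  · have hsplit : t ^ p = t ^ (p - 2) * t ^ 2 := by
      rw [← Real.rpow_two, ← Real.rpow_add' ht (by linarith), sub_add_cancel]
    rw [hsplit]
    refine le_add_of_le_of_nonneg ?_ (by positivity)
    gcongr
  · have hsplit : t ^ (3 - p) * t ^ p = t ^ 3 := by
      rw [← Real.rpow_add' ht (by norm_num), sub_add_cancel]
      norm_cast
    have hlarge : c⁻¹ ≤ t ^ (3 - p) := by
      rw [← Real.rpow_inv_rpow (inv_nonneg.2 hc.le) (by linarith : 3 - p ≠ 0)]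
      exact Real.rpow_le_rpow (by positivity) hβt (by linarith)
    refine le_add_of_nonneg_of_le (by positivity) ?_
    rw [← hsplit, ← mul_assoc]
    exact le_mul_of_one_le_left (by positivity) ((inv_le_iff_one_le_mul₀' hc).1 hlarge)

namespace IsTestFunction

variable {v : R3 → ℝ}

theorem integrable_norm_gradient_sq (hv : IsTestFunction v) :
    Integrable fun x => ‖gradient v x‖ ^ 2 :=
  (hv.memLp_gradient 2).integrable_norm_pow two_ne_zero

theorem integrable_sq (hv : IsTestFunction v) : Integrable fun x => v x ^ 2 :=
  (hv.memLp 2).integrable_sq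

theorem integrable_abs_cube (hv : IsTestFunction v) : Integrable fun x => |v x| ^ 3 :=
  (hv.memLp 3).integrable_norm_pow three_ne_zero

theorem energy_eq (hv : IsTestFunction v) (p lam : ℝ) :
    energy p lam v = (1 / 2) * sobolevSq v + (lam / 4) * (coulombEnergy v).toReal
      - (1 / p) * ∫ x, |v x| ^ p :=
  SchrodingerPoissonSlater.energy_eq hv.mem_H1 hv.hasL2WeakGradient p lam

theorem sq_integral_abs_cube_le (hv : IsTestFunction v) :
    (∫ x, |v x| ^ 3) ^ 2
      ≤ 4 / π * ((∫ x, ‖gradient v x‖ ^ 2) * (coulombEnergy v).toReal) := by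
  have hcoulomb := coulombEnergy_ne_top (hv.memLp 2) (hv.memLp 4)
  have hgrad : ∫⁻ x, ‖fderiv ℝ v x‖ₑ ^ 2 = ENNReal.ofReal (∫ x, ‖gradient v x‖ ^ 2) := by
    rw [ofReal_integral_eq_lintegral_ofReal hv.integrable_norm_gradient_sq
      (ae_of_all _ fun x => by positivity)]
    refine lintegral_congr fun x => ?_
    rw [ENNReal.ofReal_pow (norm_nonneg _), norm_gradient, ofReal_norm]
  have hcube : ∫⁻ x, ‖v x‖ₑ ^ 3 = ENNReal.ofReal (∫ x, |v x| ^ 3) := by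
    rw [ofReal_integral_eq_lintegral_ofReal hv.integrable_abs_cube
      (ae_of_all _ fun x => by positivity)]
    simp [ENNReal.ofReal_pow, Real.enorm_eq_ofReal_abs]
  have key := sq_lintegral_enorm_pow_three_le hv.contDiff_one hv.hasCompactSupport
  rw [hgrad, hcube, ← ENNReal.ofReal_toReal hcoulomb,
    ← ENNReal.ofReal_pow (by positivity), ← ENNReal.ofReal_mul (by positivity),
    ← ENNReal.ofReal_mul (by positivity)] at key
  exact (ENNReal.ofReal_le_ofReal_iff (by positivity)).1 key

theorem norm_mul_abs_le (hv : IsTestFunction v) (hr : IsRadial v) (x : R3) :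
    ‖x‖ * |v x| ≤ √(sobolevSq v / (4 * π)) := by
  have hfderiv (y : R3) :
      ‖fderiv ℝ (fun z => v z ^ 2) y‖ ≤ ‖gradient v y‖ ^ 2 + v y ^ 2 := by
    rw [fderiv_fun_pow 2 (hv.contDiff_one.differentiable one_ne_zero y), norm_smul, norm_gradient,
      ← sq_abs (v y)]
    simpa [mul_right_comm, add_comm] using two_mul_le_add_sq |v y| ‖fderiv ℝ v y‖
  have hint : Integrable fun y => ‖gradient v y‖ ^ 2 + v y ^ 2 :=
    hv.integrable_norm_gradient_sq.add hv.integrable_sq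
  have htotal : ∫⁻ y, ‖fderiv ℝ (fun z => v z ^ 2) y‖ₑ ≤ ENNReal.ofReal (sobolevSq v) := by
    rw [sobolevSq, ← integral_add hv.integrable_norm_gradient_sq hv.integrable_sq,
      ofReal_integral_eq_lintegral_ofReal hint (ae_of_all _ fun y => by positivity)]
    refine lintegral_mono fun y => ?_
    rw [← ofReal_norm]
    exact ENNReal.ofReal_le_ofReal (hfderiv y)
  have hsq_radial : IsRadial fun z => v z ^ 2 := fun y z h => congrArg (· ^ 2) (hr y z h)
  have key := (hsq_radial.toSphere_mul_enorm_le_lintegral_fderiv volume (hv.contDiff_one.pow 2)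
    (hv.hasCompactSupport.comp_left (g := (· ^ 2)) (zero_pow two_ne_zero)) x).trans htotal
  rw [toSphere_univ_R3, finrank_euclideanSpace_fin, Real.enorm_of_nonneg (sq_nonneg _),
    ← ENNReal.ofReal_mul (by positivity), ← ENNReal.ofReal_mul (by positivity),
    ENNReal.ofReal_le_ofReal_iff (sobolevSq_nonneg v)] at key
  refine Real.le_sqrt_of_sq_le ?_
  rw [le_div_iff₀' (by positivity), mul_pow, sq_abs]
  exact key

theorem sq_setIntegral_sq_le (hv : IsTestFunction v) {ρ : ℝ} (hρ : 0 ≤ ρ) :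
    (∫ x in Metric.closedBall 0 ρ, v x ^ 2) ^ 2 ≤ 2 * ρ * (coulombEnergy v).toReal := by
  have hball {x y : R3} (hx : x ∈ Metric.closedBall 0 ρ) (hy : y ∈ Metric.closedBall 0 ρ) :
      ‖x - y‖ₑ ≤ ENNReal.ofReal (2 * ρ) := by
    rw [mem_closedBall_zero_iff] at hx hy
    rw [← ofReal_norm]
    exact ENNReal.ofReal_le_ofReal ((norm_sub_le x y).trans (by linarith))
  have hmass : ∫⁻ x in Metric.closedBall 0 ρ, ‖v x‖ₑ ^ 2
      = ENNReal.ofReal (∫ x in Metric.closedBall 0 ρ, v x ^ 2) := by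
    rw [ofReal_integral_eq_lintegral_ofReal hv.integrable_sq.integrableOn
      (ae_of_all _ fun x => by positivity)]
    simp only [← Real.enorm_of_nonneg (sq_nonneg (v _)), enorm_pow]
  have key := sq_setLIntegral_le (hv.contDiff.continuous.measurable.enorm.pow_const 2).aemeasurable
    Metric.isClosed_closedBall.measurableSet fun x hx y hy => hball hx hy
  rw [hmass] at key
  change _ ≤ _ * coulombEnergy v at key
  rw [← ENNReal.ofReal_toReal (coulombEnergy_ne_top (hv.memLp 2) (hv.memLp 4)),
    ← ENNReal.ofReal_pow (by positivity), ← ENNReal.ofReal_mul (by positivity)] at key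
  exact (ENNReal.ofReal_le_ofReal_iff (by positivity)).1 key

theorem mul_integral_abs_cube_le (hv : IsTestFunction v) {ε : ℝ} (hε : 0 < ε) :
    √(π * ε) * (∫ x, |v x| ^ 3) ≤ (∫ x, ‖gradient v x‖ ^ 2) + ε * (coulombEnergy v).toReal := by
  refine le_add_of_sq_le_four_mul (by positivity) (by positivity) ?_
  rw [mul_pow, Real.sq_sqrt (by positivity)]
  have key := mul_le_mul_of_nonneg_left hv.sq_integral_abs_cube_le
    (by positivity : 0 ≤ π * ε)
  refine key.trans_eq ?_
  field_simp

theorem integrable_abs_rpow (hv : IsTestFunction v) {p : ℝ} (hp : p ∈ Ioo (2 : ℝ) 3) :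
    Integrable fun x => |v x| ^ p :=
  integrable_abs_rpow_of_mem_H1 hv.mem_H1 hp.1.le (by linarith [hp.2])

theorem integral_abs_rpow_le (hv : IsTestFunction v) {p : ℝ} (hp : p ∈ Ioo (2 : ℝ) 3) :
    ∫ x, |v x| ^ p ≤ (∫ x, v x ^ 2) + ∫ x, |v x| ^ 3 := by
  rw [← integral_add hv.integrable_sq hv.integrable_abs_cube]
  refine integral_mono (hv.integrable_abs_rpow hp)
    (hv.integrable_sq.add hv.integrable_abs_cube) fun x => ?_
  simpa using rpow_le_sq_add_cube hp (abs_nonneg (v x))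

theorem energy_nonneg (hv : IsTestFunction v) {p : ℝ} (hp : p ∈ Ioo (2 : ℝ) 3) :
    0 ≤ energy p (2 / π) v := by
  have hcube : ∫ x, |v x| ^ 3 ≤ (∫ x, ‖gradient v x‖ ^ 2) + π⁻¹ * (coulombEnergy v).toReal := by
    simpa [Real.pi_ne_zero] using hv.mul_integral_abs_cube_le (inv_pos.2 Real.pi_pos)
  have hrpow : (1 / p) * (∫ x, |v x| ^ p) ≤ (1 / 2) * ∫ x, |v x| ^ p := by
    gcongr
    exact hp.1.le
  rw [hv.energy_eq, sobolevSq, show 2 / π / 4 = (1 / 2) * π⁻¹ by ring]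
  linarith [hv.integral_abs_rpow_le hp]

theorem integral_abs_rpow_le_of_isRadial {p c α M : ℝ} (hp : p ∈ Ioo (2 : ℝ) 3) (hc : 0 ≤ c)
    (hα : 0 < α) (hsmall : ∀ t : ℝ, 0 ≤ t → t ≤ α → t ^ p ≤ (1 / 2) * t ^ 2)
    (hlarge : ∀ t : ℝ, 0 ≤ t → t ^ p ≤ M * t ^ 2 + c * t ^ 3)
    (hv : IsTestFunction v) (hr : IsRadial v) :
    ∫ x, |v x| ^ p ≤ (1 / 2) * (∫ x, v x ^ 2) + c * (∫ x, |v x| ^ 3)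
      + M * ∫ x in Metric.closedBall 0 (√(sobolevSq v / (4 * π)) / α), v x ^ 2 := by
  set B : Set R3 := Metric.closedBall 0 (√(sobolevSq v / (4 * π)) / α) with hB
  have hB_meas : MeasurableSet B := Metric.isClosed_closedBall.measurableSet
  have hpointwise (x : R3) : |v x| ^ p
      ≤ (1 / 2) * v x ^ 2 + c * |v x| ^ 3 + M * B.indicator (fun y => v y ^ 2) x := by
    by_cases hx : x ∈ B
    · rw [indicator_of_mem hx, ← sq_abs (v x)]
      linarith [hlarge |v x| (abs_nonneg _), sq_nonneg |v x|]
    · have hvα : |v x| ≤ α := by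
        rw [hB, mem_closedBall_zero_iff, not_le, div_lt_iff₀ hα] at hx
        have hx0 : 0 < ‖x‖ := pos_of_mul_pos_left ((Real.sqrt_nonneg _).trans_lt hx) hα.le
        exact le_of_mul_le_mul_left ((hv.norm_mul_abs_le hr x).trans hx.le) hx0
      rw [indicator_of_notMem hx, ← sq_abs (v x)]
      have : 0 ≤ c * |v x| ^ 3 := by positivity
      linarith [hsmall |v x| (abs_nonneg _) hvα]
  have hsq := hv.integrable_sq.const_mul (1 / 2)
  have hcube := hv.integrable_abs_cube.const_mul c
  have hsum : Integrable fun x => (1 / 2) * v x ^ 2 + c * |v x| ^ 3 := hsq.add hcube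
  have hind := (hv.integrable_sq.indicator hB_meas).const_mul M
  rw [← integral_indicator hB_meas, ← integral_const_mul, ← integral_const_mul,
    ← integral_const_mul, ← integral_add hsq hcube, ← integral_add hsum hind]
  exact integral_mono (hv.integrable_abs_rpow hp) (hsum.add hind) hpointwise

end IsTestFunction

theorem exists_forall_isRadial_le_energy {p lam : ℝ} (hp : p ∈ Ioo (2 : ℝ) 3) (hlam : 0 < lam) :
    ∃ m : ℝ, ∀ v : R3 → ℝ, IsTestFunction v → IsRadial v → m ≤ energy p lam v := by
  set c : ℝ := √(π * (lam / 2)) / 2 with hc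
  obtain ⟨α, hα, hsmall⟩ := exists_rpow_le_mul_sq hp.1
  obtain ⟨M, hlarge⟩ := exists_rpow_le_mul_sq_add hp (c := c) (by positivity)
  set κ : ℝ := M ^ 2 / (lam * α) with hκ
  refine ⟨-κ ^ 2, fun v hv hr => ?_⟩
  set D := (coulombEnergy v).toReal
  set s : ℝ := √(sobolevSq v / (4 * π)) with hs
  set m : ℝ := ∫ x in Metric.closedBall 0 (s / α), v x ^ 2
  have hN : sobolevSq v = 4 * π * s ^ 2 := by
    rw [hs, Real.sq_sqrt (div_nonneg (sobolevSq_nonneg v) (by positivity))]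
    field_simp
  have hrpow : ∫ x, |v x| ^ p ≤ (1 / 2) * (∫ x, v x ^ 2) + c * (∫ x, |v x| ^ 3) + M * m :=
    hv.integral_abs_rpow_le_of_isRadial hp (by positivity) hα hsmall hlarge hr
  have hcube : 2 * c * (∫ x, |v x| ^ 3) ≤ (∫ x, ‖gradient v x‖ ^ 2) + lam / 2 * D := by
    simpa [hc, mul_div_cancel₀] using hv.mul_integral_abs_cube_le (half_pos hlam)
  have hball : (1 / 2) * M * m ≤ lam / 8 * D + κ * s := by
    refine le_add_of_sq_le_four_mul (by positivity) (by positivity) ?_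
    calc ((1 / 2) * M * m) ^ 2 = M ^ 2 / 4 * m ^ 2 := by ring
      _ ≤ M ^ 2 / 4 * (2 * (s / α) * D) := by
        gcongr
        exact hv.sq_setIntegral_sq_le (by positivity)
      _ = 4 * (lam / 8 * D * (κ * s)) := by
        rw [hκ]
        field_simp
        ring
  have hdiv : (1 / p) * (∫ x, |v x| ^ p) ≤ (1 / 2) * ∫ x, |v x| ^ p := by
    gcongr
    exact hp.1.le
  have : 0 ≤ ∫ x, ‖gradient v x‖ ^ 2 := by positivity
  have hquarter : (1 / 4) * sobolevSq v - κ * s ≤ energy p lam v := by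
    rw [hv.energy_eq]
    unfold sobolevSq
    linarith
  have hsquare : -κ ^ 2 ≤ (1 / 4) * sobolevSq v - κ * s := by
    rw [hN]
    nlinarith [Real.pi_gt_three, sq_nonneg (s - κ), sq_nonneg s, sq_nonneg κ]
  exact hsquare.trans hquarter

end RadialBound

section DistantCopies

theorem integral_comp_add_of_disjoint {α E : Type*} [MeasurableSpace α] {μ : Measure α}
    [AddZeroClass E] {φ : E → ℝ} (hφ : φ 0 = 0) {f g : α → E}
    (h : Disjoint (Function.support f) (Function.support g))
    (hf : Integrable (fun x => φ (f x)) μ) (hg : Integrable (fun x => φ (g x)) μ) :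
    ∫ x, φ (f x + g x) ∂μ = (∫ x, φ (f x) ∂μ) + ∫ x, φ (g x) ∂μ := by
  rw [← integral_add hf hg]
  refine integral_congr_ae (ae_of_all _ fun x => ?_)
  by_cases hx : f x = 0
  · simp [hx, hφ]
  · simp [Function.notMem_support.1 (disjoint_left.1 h hx), hφ]

theorem coulombPairing_le_of_separated {f g : R3 → ℝ≥0∞} (hf : AEMeasurable f)
    (hg : AEMeasurable g) {K : ℝ≥0∞}
    (hK : ∀ x ∈ Function.support f, ∀ y ∈ Function.support g, K ≤ ‖x - y‖ₑ) :
    coulombPairing f g ≤ (∫⁻ x, f x) * (∫⁻ y, g y) * K⁻¹ := by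
  have hkernel (x y : R3) : f x * g y * ‖x - y‖ₑ⁻¹ ≤ f x * g y * K⁻¹ := by
    by_cases hx : f x = 0
    · simp [hx]
    by_cases hy : g y = 0
    · simp [hy]
    gcongr
    exact hK x hx y hy
  calc coulombPairing f g ≤ ∫⁻ x, ∫⁻ y, f x * g y * K⁻¹ :=
        lintegral_mono fun x => lintegral_mono (hkernel x)
    _ = (∫⁻ x, f x) * (∫⁻ y, g y) * K⁻¹ := by
        simp only [mul_assoc]
        rw [← lintegral_mul_const'' _ hf]
        refine lintegral_congr fun x => ?_
        rw [lintegral_const_mul'' _ (hg.mul_const _), lintegral_mul_const'' _ hg]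

theorem coulombEnergy_add_of_disjoint {v w : R3 → ℝ} (hv : AEStronglyMeasurable v)
    (hw : AEStronglyMeasurable w) (h : Disjoint (Function.support v) (Function.support w)) :
    coulombEnergy (v + w) = coulombEnergy v + coulombEnergy w
      + 2 * coulombPairing (fun x => ‖v x‖ₑ ^ 2) fun x => ‖w x‖ₑ ^ 2 := by
  have hv2 : AEMeasurable fun x => ‖v x‖ₑ ^ 2 := hv.enorm.pow_const 2
  have hw2 : AEMeasurable fun x => ‖w x‖ₑ ^ 2 := hw.enorm.pow_const 2
  have hsplit : (fun x => ‖(v + w) x‖ₑ ^ 2) = (fun x => ‖v x‖ₑ ^ 2) + fun x => ‖w x‖ₑ ^ 2 := by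
    ext x
    by_cases hx : v x = 0
    · simp [hx]
    · simp [Function.notMem_support.1 (disjoint_left.1 h hx)]
  rw [coulombEnergy, hsplit, coulombPairing_add_left hv2 (hv2.add hw2),
    coulombPairing_add_right hv2 hv2 hw2, coulombPairing_add_right hw2 hv2 hw2,
    coulombPairing_comm hw2 hv2, coulombEnergy, coulombEnergy]
  ring

theorem coulombEnergy_comp_sub_right (v : R3 → ℝ) (y : R3) :
    coulombEnergy (fun x => v (x - y)) = coulombEnergy v := by
  let f (x z : R3) : ℝ≥0∞ := ‖v x‖ₑ ^ 2 * ‖v z‖ₑ ^ 2 * ‖x - z‖ₑ⁻¹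
  calc coulombEnergy (fun x => v (x - y)) = ∫⁻ x, ∫⁻ z, f (x - y) (z - y) := by
        simp only [coulombEnergy, coulombPairing, f, sub_sub_sub_cancel_right]
    _ = ∫⁻ x, ∫⁻ z, f (x - y) z := lintegral_congr fun x => lintegral_sub_right_eq_self _ y
    _ = coulombEnergy v := lintegral_sub_right_eq_self (fun x => ∫⁻ z, f x z) y

theorem support_gradient_subset (v : R3 → ℝ) : Function.support (gradient v) ⊆ tsupport v :=
  fun x hx => support_fderiv_subset ℝ fun h => hx (by rw [gradient, h, map_zero])

namespace IsTestFunction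

variable {v w : R3 → ℝ}

theorem add (hv : IsTestFunction v) (hw : IsTestFunction w) : IsTestFunction (v + w) :=
  ⟨hv.contDiff.add hw.contDiff, hv.hasCompactSupport.add hw.hasCompactSupport⟩

theorem comp_sub_right (hv : IsTestFunction v) (y : R3) : IsTestFunction fun x => v (x - y) :=
  ⟨hv.contDiff.comp (contDiff_id.sub contDiff_const),
    hv.hasCompactSupport.comp_homeomorph (Homeomorph.subRight y)⟩

theorem gradient_add (hv : IsTestFunction v) (hw : IsTestFunction w) (x : R3) :
    gradient (v + w) x = gradient v x + gradient w x := by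
  simp only [gradient, ← map_add]
  rw [fderiv_add (hv.contDiff_one.differentiable one_ne_zero x)
    (hw.contDiff_one.differentiable one_ne_zero x)]

theorem sobolevSq_add_of_disjoint (hv : IsTestFunction v) (hw : IsTestFunction w)
    (h : Disjoint (tsupport v) (tsupport w)) :
    sobolevSq (v + w) = sobolevSq v + sobolevSq w := by
  have hgrad := integral_comp_add_of_disjoint (φ := fun z : R3 => ‖z‖ ^ 2) (by simp)
    (h.mono (support_gradient_subset v) (support_gradient_subset w))
    hv.integrable_norm_gradient_sq hw.integrable_norm_gradient_sq
  have hmass := integral_comp_add_of_disjoint (φ := fun t : ℝ => t ^ 2) (by simp)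
    (h.mono subset_closure subset_closure) hv.integrable_sq hw.integrable_sq
  simp only [sobolevSq, hv.gradient_add hw, Pi.add_apply, hgrad, hmass]
  ring

theorem coulombPairing_sq_le_of_separated (hv : IsTestFunction v) (hw : IsTestFunction w) {K : ℝ}
    (hK : 0 < K) (h : ∀ x ∈ tsupport v, ∀ y ∈ tsupport w, K ≤ ‖x - y‖) :
    coulombPairing (fun x => ‖v x‖ₑ ^ 2) (fun x => ‖w x‖ₑ ^ 2)
      ≤ ENNReal.ofReal ((∫ x, v x ^ 2) * (∫ x, w x ^ 2) / K) := by
  have hmass {u : R3 → ℝ} (hu : IsTestFunction u) :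
      ∫⁻ x, ‖u x‖ₑ ^ 2 = ENNReal.ofReal (∫ x, u x ^ 2) := by
    rw [ofReal_integral_eq_lintegral_ofReal hu.integrable_sq (ae_of_all _ fun x => by positivity)]
    simp only [← Real.enorm_of_nonneg (sq_nonneg (u _)), enorm_pow]
  have hmeas {u : R3 → ℝ} (hu : IsTestFunction u) : AEMeasurable fun x => ‖u x‖ₑ ^ 2 :=
    (hu.contDiff.continuous.measurable.enorm.pow_const 2).aemeasurable
  have hsupport {u : R3 → ℝ} {x : R3} (hx : x ∈ Function.support fun x => ‖u x‖ₑ ^ 2) :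
      x ∈ tsupport u := subset_closure (by simpa using hx)
  refine (coulombPairing_le_of_separated (K := ENNReal.ofReal K) (hmeas hv) (hmeas hw)
    fun x hx y hy => ?_).trans_eq ?_
  · rw [← ofReal_norm]
    exact ENNReal.ofReal_le_ofReal (h x (hsupport hx) y (hsupport hy))
  · rw [hmass hv, hmass hw, div_eq_mul_inv, ENNReal.ofReal_mul (by positivity),
      ENNReal.ofReal_mul (by positivity), ENNReal.ofReal_inv_of_pos hK]

theorem energy_add_le (hv : IsTestFunction v) (hw : IsTestFunction w) {p : ℝ}
    (hp : p ∈ Ioo (2 : ℝ) 3) (lam : ℝ) {K : ℝ} (hK : 0 < K)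
    (h : ∀ x ∈ tsupport v, ∀ y ∈ tsupport w, K ≤ ‖x - y‖) :
    energy p lam (v + w) ≤ energy p lam v + energy p lam w
      + |lam| / 2 * ((∫ x, v x ^ 2) * (∫ x, w x ^ 2) / K) := by
  have hdisj : Disjoint (tsupport v) (tsupport w) :=
    disjoint_left.2 fun x hx hx' => (hK.trans_le (h x hx x hx')).ne' (by simp)
  have hsupport : Disjoint (Function.support v) (Function.support w) :=
    hdisj.mono subset_closure subset_closure
  have hp0 : p ≠ 0 := by linarith [hp.1]
  have hrpow := integral_comp_add_of_disjoint (φ := fun t : ℝ => |t| ^ p) (by simp [hp0]) hsupport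
    (hv.integrable_abs_rpow hp) (hw.integrable_abs_rpow hp)
  have hpairing := hv.coulombPairing_sq_le_of_separated hw hK h
  set P := coulombPairing (fun x => ‖v x‖ₑ ^ 2) fun x => ‖w x‖ₑ ^ 2
  have hcoulomb : (coulombEnergy (v + w)).toReal
      = (coulombEnergy v).toReal + (coulombEnergy w).toReal + 2 * P.toReal := by
    have hv_top := coulombEnergy_ne_top (hv.memLp 2) (hv.memLp 4)
    have hw_top := coulombEnergy_ne_top (hw.memLp 2) (hw.memLp 4)
    have hP_top : P ≠ ⊤ := ne_top_of_le_ne_top ENNReal.ofReal_ne_top hpairing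
    rw [coulombEnergy_add_of_disjoint (hv.memLp 2).1 (hw.memLp 2).1 hsupport,
      ENNReal.toReal_add (ENNReal.add_ne_top.2 ⟨hv_top, hw_top⟩)
        (ENNReal.mul_ne_top (by simp) hP_top), ENNReal.toReal_add hv_top hw_top,
      ENNReal.toReal_mul, ENNReal.toReal_ofNat]
  have hP : lam * P.toReal ≤ |lam| * ((∫ x, v x ^ 2) * (∫ x, w x ^ 2) / K) :=
    mul_le_mul (le_abs_self lam) (ENNReal.toReal_le_of_le_ofReal (by positivity) hpairing)
      ENNReal.toReal_nonneg (abs_nonneg lam)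
  rw [(hv.add hw).energy_eq, hv.energy_eq, hw.energy_eq, hv.sobolevSq_add_of_disjoint hw hdisj,
    hcoulomb]
  simp only [Pi.add_apply, hrpow]
  linarith

theorem energy_comp_sub_right (hv : IsTestFunction v) (p lam : ℝ) (y : R3) :
    energy p lam (fun x => v (x - y)) = energy p lam v := by
  have hgrad (x : R3) : gradient (fun x => v (x - y)) x = gradient v (x - y) := by
    rw [gradient, gradient, fderiv_comp_sub]
  rw [(hv.comp_sub_right y).energy_eq, hv.energy_eq, coulombEnergy_comp_sub_right, sobolevSq,
    sobolevSq, integral_sub_right_eq_self (fun x => v x ^ 2) y,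
    integral_sub_right_eq_self (fun x => |v x| ^ p) y]
  simp only [hgrad]
  rw [integral_sub_right_eq_self (fun x => ‖gradient v x‖ ^ 2) y]

theorem exists_energy_lt_two_mul_add (hv : IsTestFunction v) {p : ℝ} (hp : p ∈ Ioo (2 : ℝ) 3)
    (lam : ℝ) {ε : ℝ} (hε : 0 < ε) :
    ∃ w, IsTestFunction w ∧ energy p lam w < 2 * energy p lam v + ε := by
  obtain ⟨R, hR⟩ := hv.hasCompactSupport.isCompact.isBounded.subset_closedBall (0 : R3)
  have hnorm {x : R3} (hx : x ∈ tsupport v) : ‖x‖ ≤ R := by simpa using hR hx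
  set B := ∫ x, v x ^ 2
  set K : ℝ := |lam| * (B * B) / ε + 1
  have hK : 0 < K := by positivity
  obtain ⟨y, hy⟩ := NormedSpace.exists_lt_norm ℝ R3 (2 * R + K)
  have hw := hv.comp_sub_right y
  have hfar : ∀ x ∈ tsupport v, ∀ z ∈ tsupport fun x => v (x - y), K ≤ ‖x - z‖ := by
    intro x hx z hz
    have hz' : z - y ∈ tsupport v :=
      tsupport_comp_subset_preimage v (f := fun x => x - y) (by fun_prop) hz
    have htriangle : ‖y‖ ≤ ‖x‖ + ‖z - y‖ + ‖x - z‖ := by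
      simpa using (norm_sub_le (x - (z - y)) (x - z)).trans
        (add_le_add_left (norm_sub_le x (z - y)) _)
    linarith [hnorm hx, hnorm hz']
  have hadd := hv.energy_add_le hw hp lam hK hfar
  rw [hv.energy_comp_sub_right, integral_sub_right_eq_self (fun x => v x ^ 2) y] at hadd
  have hsmall : |lam| / 2 * (B * B / K) < ε := by
    have hεK : ε * K = |lam| * (B * B) + ε := by
      simp only [K]
      field_simp
    rw [mul_div_assoc', div_lt_iff₀ hK, hεK]
    have : 0 ≤ |lam| * (B * B) := by positivity
    linarith
  exact ⟨_, hv.add hw, by linarith⟩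

end IsTestFunction

theorem not_bddBelow_of_energy_neg {p lam : ℝ} (hp : p ∈ Ioo (2 : ℝ) 3) {v : R3 → ℝ}
    (hv : IsTestFunction v) (hneg : energy p lam v < 0) :
    ¬ BddBelow (energy p lam '' {w | IsTestFunction w}) := by
  intro hbdd
  set m := sInf (energy p lam '' {w | IsTestFunction w})
  have hm {w : R3 → ℝ} (hw : IsTestFunction w) : m ≤ energy p lam w :=
    csInf_le hbdd (mem_image_of_mem _ hw)
  have hdouble : ∀ e ∈ energy p lam '' {w | IsTestFunction w}, m / 2 ≤ e := by
    rintro _ ⟨w, hw, rfl⟩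
    have : m ≤ 2 * energy p lam w := le_of_forall_pos_le_add fun ε hε =>
      let ⟨_, hw', hlt⟩ := IsTestFunction.exists_energy_lt_two_mul_add hw hp lam hε
      (hm hw').trans hlt.le
    linarith
  have hm_half : m / 2 ≤ m := le_csInf ⟨_, mem_image_of_mem _ hv⟩ hdouble
  linarith [hm hv]

end DistantCopies

section Threshold

namespace IsTestFunction

variable {v : R3 → ℝ}

theorem const_mul (hv : IsTestFunction v) (t : ℝ) : IsTestFunction fun x => t * v x :=
  ⟨contDiff_const.mul hv.contDiff, hv.hasCompactSupport.mul_left⟩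

theorem sobolevSq_const_mul (hv : IsTestFunction v) (t : ℝ) :
    sobolevSq (fun x => t * v x) = t ^ 2 * sobolevSq v := by
  have hgrad (x : R3) : gradient (fun x => t * v x) x = t • gradient v x := by
    rw [gradient, fderiv_const_mul (hv.contDiff_one.differentiable one_ne_zero x), map_smulₛₗ]
    rfl
  simp only [sobolevSq, hgrad, norm_smul, mul_pow, Real.norm_eq_abs, sq_abs, integral_const_mul]
  ring

theorem energy_zero_const_mul (hv : IsTestFunction v) (p : ℝ) {t : ℝ} (ht : 0 ≤ t) :
    energy p 0 (fun x => t * v x)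
      = (1 / 2) * (t ^ 2 * sobolevSq v) - (1 / p) * (t ^ p * ∫ x, |v x| ^ p) := by
  rw [(hv.const_mul t).energy_eq, hv.sobolevSq_const_mul]
  simp only [abs_mul, abs_of_nonneg ht, Real.mul_rpow ht (abs_nonneg _), integral_const_mul]
  ring

theorem exists_energy_zero_const_mul_neg (hv : IsTestFunction v) {p : ℝ} (hp : 2 < p)
    (hpos : 0 < ∫ x, |v x| ^ p) : ∃ t : ℝ, energy p 0 (fun x => t * v x) < 0 := by
  set I := ∫ x, |v x| ^ p
  have hlim : Tendsto (fun t : ℝ => t ^ (p - 2) * ((1 / p) * I)) atTop atTop :=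
    (tendsto_rpow_atTop (by linarith)).atTop_mul_const (by positivity)
  obtain ⟨t, hlarge, ht⟩ :=
    ((hlim.eventually_gt_atTop ((1 / 2) * sobolevSq v)).and (eventually_gt_atTop 0)).exists
  refine ⟨t, ?_⟩
  have hsplit : t ^ p = t ^ 2 * t ^ (p - 2) := by
    rw [← Real.rpow_two, ← Real.rpow_add ht, add_sub_cancel]
  rw [hv.energy_zero_const_mul p ht.le, hsplit]
  linarith [mul_lt_mul_of_pos_left hlarge (sq_pos_of_pos ht)]

end IsTestFunction

theorem isTestFunction_cutoff {r : ℝ} (hr : 0 < r) : IsTestFunction (cutoff r) :=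
  ⟨contDiff_cutoff r, hasCompactSupport_cutoff hr⟩

theorem exists_isTestFunction_energy_zero_neg {p : ℝ} (hp : 2 < p) :
    ∃ v, IsTestFunction v ∧ energy p 0 v < 0 := by
  have hv := isTestFunction_cutoff one_pos
  have hp0 : 0 < p := by linarith
  have hpos : 0 < ∫ x : R3, |cutoff 1 x| ^ p :=
    Continuous.integral_pos_of_hasCompactSupport_nonneg_nonzero (x := 0)
      (hv.contDiff.continuous.abs.rpow_const fun _ => Or.inr hp0.le)
      (hv.hasCompactSupport.comp_left (g := fun s : ℝ => |s| ^ p) (by simp [hp0.ne']))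
      (fun x => by positivity) (by simp [cutoff_eq_one])
  obtain ⟨t, ht⟩ := hv.exists_energy_zero_const_mul_neg hp hpos
  exact ⟨_, hv.const_mul t, ht⟩

theorem isTestFunction_zero : IsTestFunction 0 := ⟨contDiff_const, HasCompactSupport.zero⟩

theorem energy_zero_right {p : ℝ} (hp : p ≠ 0) (lam : ℝ) : energy p lam 0 = 0 := by
  have hgrad : gradient (0 : R3 → ℝ) = 0 := by
    ext1 x
    simp [gradient]
  rw [isTestFunction_zero.energy_eq, sobolevSq, hgrad]
  simp [coulombEnergy, coulombPairing, hp]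

theorem energy_mono {u : R3 → ℝ} (hu : u ∈ H1) (p : ℝ) : Monotone fun lam => energy p lam u := by
  intro lam lam' h
  simp only [energy_eq hu (hasL2WeakGradient_weakGradient hu)]
  gcongr

theorem continuous_energy {u : R3 → ℝ} (hu : u ∈ H1) (p : ℝ) :
    Continuous fun lam => energy p lam u := by
  simp only [energy_eq hu (hasL2WeakGradient_weakGradient hu)]
  fun_prop

theorem energy_nonneg_of_two_div_pi {p : ℝ} (hp : p ∈ Ioo (2 : ℝ) 3) {u : R3 → ℝ} (hu : u ∈ H1) :
    0 ≤ energy p (2 / Real.pi) u := by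
  obtain ⟨v, hv, hlim, -⟩ := exists_isTestFunction_tendsto_energy hu hp.1.le (by linarith [hp.2])
  exact ge_of_tendsto' (hlim _) fun n => (hv n).energy_nonneg hp

theorem exists_energy_nonneg_iff {p : ℝ} (hp : p ∈ Ioo (2 : ℝ) 3) :
    ∃ lam₀ : ℝ, 0 < lam₀ ∧ ∀ lam, (∀ u ∈ H1, 0 ≤ energy p lam u) ↔ lam₀ ≤ lam := by
  set Λ : Set ℝ := {lam | ∀ u ∈ H1, 0 ≤ energy p lam u} with hΛ
  have hmono {lam lam' : ℝ} (h : lam ≤ lam') (hlam : lam ∈ Λ) : lam' ∈ Λ := fun u hu =>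
    (hlam u hu).trans (energy_mono hu p h)
  have hclosed : IsClosed Λ := by
    simp only [hΛ, ofPred_forall]
    exact isClosed_biInter fun u hu => isClosed_le continuous_const (continuous_energy hu p)
  have hnonempty : Λ.Nonempty := ⟨_, fun _ hu => energy_nonneg_of_two_div_pi hp hu⟩
  have hzero : 0 ∉ Λ := fun h =>
    let ⟨v, hv, hneg⟩ := exists_isTestFunction_energy_zero_neg hp.1
    hneg.not_ge (h v hv.mem_H1)
  have hpos {lam : ℝ} (h : lam ∈ Λ) : 0 < lam := by
    by_contra! hle
    exact hzero (hmono hle h)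
  have hbdd : BddBelow Λ := ⟨0, fun lam h => (hpos h).le⟩
  have hmem : sInf Λ ∈ Λ := hclosed.csInf_mem hnonempty hbdd
  exact ⟨sInf Λ, hpos hmem, fun lam => ⟨fun h => csInf_le hbdd h, fun h => hmono h hmem⟩⟩

theorem iInf_energy_eq_zero {p lam : ℝ} (hp : p ≠ 0) (h : ∀ u ∈ H1, 0 ≤ energy p lam u) :
    ⨅ u ∈ H1, ((energy p lam u : ℝ) : EReal) = 0 := by
  refine le_antisymm ?_ (le_iInf₂ fun u hu => by exact_mod_cast h u hu)
  exact (iInf₂_le _ isTestFunction_zero.mem_H1).trans_eq (by simp [energy_zero_right hp])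

theorem iInf_energy_eq_bot {p lam : ℝ} (hp : p ∈ Ioo (2 : ℝ) 3) {u : R3 → ℝ} (hu : u ∈ H1)
    (hneg : energy p lam u < 0) : ⨅ u ∈ H1, ((energy p lam u : ℝ) : EReal) = ⊥ := by
  obtain ⟨v, hv, hlim, -⟩ := exists_isTestFunction_tendsto_energy hu hp.1.le (by linarith [hp.2])
  obtain ⟨n, hn⟩ := ((hlim lam).eventually_lt_const hneg).exists
  refine EReal.eq_bot_iff_forall_lt _ |>.2 fun b => ?_
  obtain ⟨_, ⟨w, hw, rfl⟩, hlt⟩ := not_bddBelow_iff.1 (not_bddBelow_of_energy_neg hp (hv n) hn) b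
  exact (iInf₂_le w hw.mem_H1).trans_lt (by exact_mod_cast hlt)

theorem bddBelow_energy_H1rad {p lam : ℝ} (hp : p ∈ Ioo (2 : ℝ) 3) (hlam : 0 < lam) :
    BddBelow (energy p lam '' H1rad) := by
  obtain ⟨m, hm⟩ := exists_forall_isRadial_le_energy hp hlam
  refine ⟨m, ?_⟩
  rintro _ ⟨u, ⟨hu, hrad⟩, rfl⟩
  obtain ⟨v, hv, hlim, hv_rad⟩ :=
    exists_isTestFunction_tendsto_energy hu hp.1.le (by linarith [hp.2])
  exact ge_of_tendsto' (hlim lam) fun n => hm _ (hv n) (hv_rad hrad n)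

theorem integrable_energy_integrands {p : ℝ} (hp2 : 2 ≤ p) (hp6 : p ≤ 6) {u : R3 → ℝ}
    (hu : u ∈ H1) :
    Integrable (fun x => ‖weakGradient u x‖ ^ 2 + u x ^ 2) ∧
      Integrable (fun z : R3 × R3 => coulombIntegrand u z.1 z.2) (volume.prod volume) ∧
      Integrable fun x => |u x| ^ p :=
  ⟨((hasL2WeakGradient_weakGradient hu).memLp.integrable_norm_pow two_ne_zero).add
      hu.1.integrable_sq,
    integrable_coulombIntegrand hu.1 (memLp_four_of_mem_H1 hu),
    integrable_abs_rpow_of_mem_H1 hu hp2 hp6⟩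

end Threshold

end SchrodingerPoissonSlater

end

open SchrodingerPoissonSlater MeasureTheory in
/-- The first conjunct says that all integrals in the energy converge on `H¹(ℝ³)`; the infimum is
taken in the extended reals. -/
theorem theorem1p6 (p : ℝ) (hp : p ∈ Set.Ioo (2 : ℝ) 3) :
    (∀ u ∈ H1,
      Integrable (fun x => ‖weakGradient u x‖ ^ 2 + u x ^ 2) volume ∧
      Integrable (fun z : R3 × R3 => coulombIntegrand u z.1 z.2) (volume.prod volume) ∧
      Integrable (fun x => |u x| ^ p) volume) ∧
    (∃ lam₀ : ℝ, 0 < lam₀ ∧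
      (∀ lam : ℝ, lam₀ ≤ lam → (⨅ u ∈ H1, ((energy p lam u : ℝ) : EReal)) = 0) ∧
      (∀ lam : ℝ, lam < lam₀ → (⨅ u ∈ H1, ((energy p lam u : ℝ) : EReal)) = ⊥)) ∧
    (∀ lam : ℝ, 0 < lam → BddBelow (energy p lam '' H1rad)) := by
  refine ⟨fun u hu => integrable_energy_integrands hp.1.le (by linarith [hp.2]) hu, ?_,
    fun lam hlam => bddBelow_energy_H1rad hp hlam⟩
  obtain ⟨lam₀, hpos, hthreshold⟩ := exists_energy_nonneg_iff hp
  refine ⟨lam₀, hpos, fun lam hlam => ?_, fun lam hlam => ?_⟩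
  · exact iInf_energy_eq_zero (by linarith [hp.1]) ((hthreshold lam).2 hlam)
  · obtain ⟨u, hu, hneg⟩ : ∃ u ∈ H1, energy p lam u < 0 := by
      by_contra! hnonneg
      exact hlam.not_ge ((hthreshold lam).1 hnonneg)
    exact iInf_energy_eq_bot hp hu hneg
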